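/- Notation. For a vector or matrix, $|\cdot|$ is the entrywise magnitude, $\preceq$ is the entrywise order, and $\max$, $\lim$, $\limsup$ are taken entrywise. $\rho(\cdot)$ is the spectral radius; a real matrix is Hurwitz if all its eigenvalues have negative real part; $M'$ is the transpose and $M^*$ the conjugate transpose of $M$; $M>0$ ($M<0$) means that the real symmetric matrix $M$ is positive (negative) definite. A function $f:\mathbb{R}^n_{\ge 0}\to\mathbb{R}^m_{\ge 0}$ is called CNI if $0\preceq x\preceq y$ implies $f(x)\preceq f(y)$. Setting. Let $N\ge 1$, $\bar\tau\ge 0$ and, for $i\in\{1,\dots,N\}$, let $A_i\in\mathbb{R}^{n\times n}$, $H_i\in\mathbb{R}^{n\times k_i}$, and let $\delta_i:\mathbb{R}^n_{\ge 0}\to\mathbb{R}^{k_i}_{\ge 0}$ be continuous and CNI. A trajectory is a continuous function $x:[-\bar\tau,\infty)\to\mathbb{R}^n$ for which there are a switching function $\sigma:[0,\infty)\to\{1,\dots,N\}$ and perturbations $w_i:[0,\infty)\to\mathbb{R}^{k_i}$ such that $$\dot x(t)=A_{\sigma(t)}x(t)+H_{\sigma(t)}w_{\sigma(t)}(t)\quad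 (t\ge 0)$$ in the sense of Carathéodory (the right-hand side is locally integrable on $[0,\infty)$ and $x(t)=x(0)+\int_0^t (A_{\sigma(s)}x(s)+H_{\sigma(s)}w_{\sigma(s)}(s))\,ds$), and $$|w_i(t)|\preceq\delta_i(\theta(t)),\qquad \theta(t)=\max_{t-\bar\tau\le s\le t}|x(s)|,\qquad\text{for all } t\ge 0 \text{ and all } i.$$ Let $V\in\mathbb{C}^{n\times n}$ be invertible. For $M\in\mathbb{C}^{n\times n}$ let $\mathcal{M}(M)$ be the real matrix with diagonal entries $\operatorname{Re}M_{jj}$ and off-diagonal entries $|M_{jk}|$, and let $\Lambda=\max_i\mathcal{M}(V^{-1}A_iV)$. Put $$\psi(x)=\max_i\ \max_{|w|\preceq\delta_i(|V|x)}|V^{-1}H_iw|,\qquad x\in\mathbb{R}^n_{\ge 0}.$$ Theorem. Suppose that $\Lambda$ is Hurwitz, that $\bar F\in\mathbb{R}^{n\times n}$ and $\bar w\in\mathbb{R}^n$ have nonnegative entries and satisfy $\psi(x)\preceq\bar Fx+\bar w$ for all $x\in\mathbb{R}^n_{\ge 0}$, and that $\rho(R)<1$, where $R=-\Lambda^{-1}\bar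 F$. Then $I-R$ is invertible, $\tilde b=(I-R)^{-1}(-\Lambda^{-1})\bar w\succeq 0$, and: (a) For every trajectory, if $|V^{-1}x(t)|\preceq\tilde b$ for $-\bar\tau\le t\le 0$, then $|V^{-1}x(t)|\preceq\tilde b$ for all $t\ge-\bar\tau$. (b) For every trajectory, $\limsup_{t\to\infty}|V^{-1}x(t)|\preceq\tilde b$. (c) Let $\delta:\mathbb{R}^n_{\ge 0}\to\mathbb{R}^n_{\ge 0}$ be continuous and CNI with $\psi(x)\preceq\delta(x)\preceq\bar Fx+\bar w$ for all $x\in\mathbb{R}^n_{\ge 0}$, and let $T_0(x)=-\Lambda^{-1}\delta(x)$. Then $b=\lim_{k\to\infty}T_0^k(\tilde b)$ exists, $b\preceq\tilde b$, and $\limsup_{t\to\infty}|V^{-1}x(t)|\preceq b$ for every trajectory. (d) There is a diagonal matrix $D>0$ such that $(\Lambda+\bar F)'D+D(\Lambda+\bar F)<0$. (e) Suppose that $\bar\tau=0$, let $D$ be any matrix as in (d), and let $L(x)=x'Px$ with $P=\operatorname{Re}\{(V^{-1})^*DV^{-1}\}$. Then the derivative of $L$ along trajectories is negative wherever the state is large: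 there is $r$ such that - for all $i$, all $x\in\mathbb{R}^n$ with $\|x\|>r$ and all $w\in\mathbb{R}^{k_i}$ with $|w|\preceq\delta_i(|x|)$, $\;x'(A_i'P+PA_i)x+2x'PH_iw<0$; - for every trajectory and every $t\ge 0$ with $\|x(t)\|>r$, the upper right Dini derivative of $s\mapsto L(x(s))$ at $t$ is negative. -/

import Mathlib

open Filter Topology MeasureTheory
open scoped Matrix

namespace SwitchSys

noncomputable section

/-- The real matrix or vector data, read as complex. -/
abbrev toC {m n : ℕ} (M : Matrix (Fin m) (Fin n) ℝ) : Matrix (Fin m) (Fin n) ℂ :=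
  M.map (fun a : ℝ => (a : ℂ))

/-- Entrywise magnitude of a complex matrix. -/
def absMat {m n : ℕ} (M : Matrix (Fin m) (Fin n) ℂ) : Matrix (Fin m) (Fin n) ℝ :=
  M.map (fun z : ℂ => ‖z‖)

/-- The vector `|M x|` of magnitudes, for a complex matrix `M` and a real vector `x`. -/
def absMulVec {m n : ℕ} (M : Matrix (Fin m) (Fin n) ℂ) (x : Fin n → ℝ) : Fin m → ℝ :=
  fun j => ‖(M *ᵥ (fun l => (x l : ℂ))) j‖

/-- The operation `𝓜`: real parts on the diagonal, magnitudes off the diagonal. -/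
def metzlerOf {n : ℕ} (M : Matrix (Fin n) (Fin n) ℂ) : Matrix (Fin n) (Fin n) ℝ :=
  Matrix.of fun i k => if i = k then (M i k).re else ‖M i k‖

/-- `Λ = max_i 𝓜(V⁻¹ A_i V)`, the maximum being taken entrywise. -/
def Lam {n N : ℕ} (A : Fin N → Matrix (Fin n) (Fin n) ℝ) (V : Matrix (Fin n) (Fin n) ℂ) :
    Matrix (Fin n) (Fin n) ℝ :=
  Matrix.of fun j k => ⨆ i : Fin N, metzlerOf (V⁻¹ * toC (A i) * V) j k

/-- All (complex) eigenvalues have negative real part. -/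
def IsHurwitz {n : ℕ} (M : Matrix (Fin n) (Fin n) ℝ) : Prop :=
  ∀ μ ∈ spectrum ℂ (toC M), μ.re < 0

/-- The spectral radius of a real matrix (over its complex eigenvalues). -/
def specRad {n : ℕ} (M : Matrix (Fin n) (Fin n) ℝ) : ENNReal :=
  spectralRadius ℂ (toC M)

/-- CNI functions `ℝⁿ₊₀ → ℝᵐ₊₀`: they map the nonnegative orthant to the nonnegative orthant and
preserve the componentwise order there. Values outside the orthant are irrelevant. -/
structure IsCNI {n m : ℕ} (f : (Fin n → ℝ) → (Fin m → ℝ)) : Prop where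
  nonneg : ∀ x, 0 ≤ x → 0 ≤ f x
  mono : ∀ x y, 0 ≤ x → x ≤ y → f x ≤ f y

/-- `θ(t) = max_{t-τ ≤ s ≤ t} |x(s)|`, componentwise. -/
def theta {n : ℕ} (τ : ℝ) (x : ℝ → Fin n → ℝ) (t : ℝ) : Fin n → ℝ :=
  fun j => sSup ((fun s => |x s j|) '' Set.Icc (t - τ) t)

/-- `ψ(x) = max_i max_{|w| ⪯ δ_i(|V|x)} |V⁻¹ H_i w|`, componentwise. -/
def psi {n N : ℕ} {k : Fin N → ℕ} (H : ∀ i, Matrix (Fin n) (Fin (k i)) ℝ)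
    (δ : ∀ i, (Fin n → ℝ) → (Fin (k i) → ℝ)) (V : Matrix (Fin n) (Fin n) ℂ)
    (x : Fin n → ℝ) : Fin n → ℝ :=
  fun j => ⨆ i : Fin N,
    sSup ((fun w : Fin (k i) → ℝ => absMulVec (V⁻¹ * toC (H i)) w j) ''
      {w | ∀ l, |w l| ≤ δ i (absMat V *ᵥ x) l})

/-- The right-hand side `A_{σ(t)} x(t) + H_{σ(t)} w_{σ(t)}(t)`. -/
def rhs {n N : ℕ} {k : Fin N → ℕ} (A : Fin N → Matrix (Fin n) (Fin n) ℝ)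
    (H : ∀ i, Matrix (Fin n) (Fin (k i)) ℝ) (σ : ℝ → Fin N)
    (w : ∀ i, ℝ → (Fin (k i) → ℝ)) (x : ℝ → Fin n → ℝ) (t : ℝ) : Fin n → ℝ :=
  A (σ t) *ᵥ x t + H (σ t) *ᵥ w (σ t) t

/-- `x`, with switching function `σ` and perturbations `w_i`, is a trajectory on `[-τ, ∞)` of the
switching system with perturbation bounds `δ_i` and maximal delay `τ`: it is continuous, solves
the differential equation for `t ≥ 0` in the sense of Carathéodory (that is, it is locally
absolutely continuous on `[0, ∞)` and satisfies the equation almost everywhere, written here in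
integral form), and the perturbations obey their bounds at all times `t ≥ 0`. -/
structure IsTrajectory {n N : ℕ} {k : Fin N → ℕ} (A : Fin N → Matrix (Fin n) (Fin n) ℝ)
    (H : ∀ i, Matrix (Fin n) (Fin (k i)) ℝ) (δ : ∀ i, (Fin n → ℝ) → (Fin (k i) → ℝ)) (τ : ℝ)
    (σ : ℝ → Fin N) (w : ∀ i, ℝ → (Fin (k i) → ℝ)) (x : ℝ → Fin n → ℝ) : Prop where
  cont : ContinuousOn x (Set.Ici (-τ))
  integrable : ∀ t, 0 ≤ t → IntervalIntegrable (rhs A H σ w x) volume 0 t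
  solves : ∀ t, 0 ≤ t → x t = x 0 + ∫ s in (0 : ℝ)..t, rhs A H σ w x s
  bound : ∀ i, ∀ t, 0 ≤ t → ∀ l, |w i t l| ≤ δ i (theta τ x t) l

/-- `limsup_{t → ∞} v(t) ⪯ b`, componentwise; the upper limits are taken in the extended reals, so
that this includes the boundedness of `v` from above for large times. -/
def LimsupLe {n : ℕ} (v : ℝ → Fin n → ℝ) (b : Fin n → ℝ) : Prop :=
  ∀ j, limsup (fun t => ((v t j : ℝ) : EReal)) atTop ≤ ((b j : ℝ) : EReal)

/-- `R = -Λ⁻¹ F`. -/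
def Rmat {n : ℕ} (Λ F : Matrix (Fin n) (Fin n) ℝ) : Matrix (Fin n) (Fin n) ℝ :=
  -Λ⁻¹ * F

/-- `b̃ = (I - R)⁻¹ (-Λ⁻¹) w̄`. -/
def bTilde {n : ℕ} (Λ F : Matrix (Fin n) (Fin n) ℝ) (wbar : Fin n → ℝ) : Fin n → ℝ :=
  (1 - Rmat Λ F)⁻¹ *ᵥ ((-Λ⁻¹) *ᵥ wbar)

/-- `T₀(x) = -Λ⁻¹ δ(x)`. -/
def Tzero {n : ℕ} (Λ : Matrix (Fin n) (Fin n) ℝ) (δ : (Fin n → ℝ) → (Fin n → ℝ))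
    (x : Fin n → ℝ) : Fin n → ℝ :=
  (-Λ⁻¹) *ᵥ δ x

/-- `D` is diagonal, positive definite, and `M' D + D M < 0`. -/
def IsDiagLyap {n : ℕ} (M D : Matrix (Fin n) (Fin n) ℝ) : Prop :=
  D.IsDiag ∧ D.PosDef ∧ (-(Mᵀ * D + D * M)).PosDef

/-- `P = Re{(V⁻¹)^* D V⁻¹}`. -/
def Pmat {n : ℕ} (V : Matrix (Fin n) (Fin n) ℂ) (D : Matrix (Fin n) (Fin n) ℝ) :
    Matrix (Fin n) (Fin n) ℝ :=
  ((V⁻¹)ᴴ * toC D * V⁻¹).map Complex.re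

/-- `L(x) = x' P x`. -/
def quadForm {n : ℕ} (P : Matrix (Fin n) (Fin n) ℝ) (x : Fin n → ℝ) : ℝ :=
  x ⬝ᵥ (P *ᵥ x)

/-- Upper right Dini derivative, in the extended reals. -/
def upperDini (f : ℝ → ℝ) (t : ℝ) : EReal :=
  limsup (fun h : ℝ => (((f (t + h) - f t) / h : ℝ) : EReal)) (𝓝[>] (0 : ℝ))

end

end SwitchSys

open SwitchSys

/-!
In the modal coordinates `z = V⁻¹ x`, differentiating `|z_j|²` shows that the vector `u = |z|`
satisfies the delay differential inequality `D⁺u ≤ Λ u + ψ(max_{t-τ ≤ s ≤ t} u(s))`, where `Λ` is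
Metzler. Following the path `Λ + s F̄`, `s ∈ [0, 1]`, along which `ρ(R) < 1` excludes singular
matrices, one finds `η > 0` with `(Λ + F̄) η < 0`; in particular `-(Λ + F̄)⁻¹ ≥ 0`, and `b̃` is the
solution of `(Λ + F̄) b̃ = -w̄`. For a small rate `r` the function `b̃ + exp (-r t) η` is therefore
a strict supersolution of the delay inequality; as `Λ` is Metzler, `u` cannot cross it, which gives
(a) and (b). If eventually `u ≤ c + ε` for every `ε > 0`, the same comparison with the delayed term
frozen at `δ(c)` gives the bound `-Λ⁻¹ δ(c)`, and iterating this from `b̃` yields (c).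

A positive `ξ` with `(Λ + F̄)' ξ < 0` exists as well, and `D = diag(ξ_i / η_i)` makes
`S = (Λ + F̄)' D + D (Λ + F̄)` a symmetric Metzler matrix with `S η < 0`, hence negative definite.
Finally `L(x) = z^* D z`, whose derivative is at most `u' S u + 2 u' D w̄`.
-/

namespace SwitchSys

/-! ### Metzler matrices -/

section Metzler

variable {ι R : Type*}

/-- A Metzler matrix: all off-diagonal entries are nonnegative. -/
def IsMetzler [Zero R] [LE R] (M : Matrix ι ι R) : Prop :=
  Pairwise fun i j => 0 ≤ M i j

theorem IsMetzler.transpose [Zero R] [LE R] {M : Matrix ι ι R} (hM : IsMetzler M) :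
    IsMetzler Mᵀ :=
  fun _ _ hij => hM hij.symm

theorem IsMetzler.add [AddZeroClass R] [Preorder R] [AddLeftMono R]
    {M F : Matrix ι ι R} (hM : IsMetzler M) (hF : IsMetzler F) : IsMetzler (M + F) :=
  fun _ _ hij => add_nonneg (hM hij) (hF hij)

variable [Fintype ι]

theorem mulVec_neg_inv_mulVec [CommRing R] [DecidableEq ι] {M : Matrix ι ι R} (hM : IsUnit M)
    (v : ι → R) : M *ᵥ (-M⁻¹ *ᵥ v) = -v := by
  rw [Matrix.neg_mulVec, Matrix.mulVec_neg, Matrix.mulVec_mulVec,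
    Matrix.mul_nonsing_inv _ ((Matrix.isUnit_iff_isUnit_det M).1 hM), Matrix.one_mulVec]

section OrderedSemiring

variable {κ : Type*} [Semiring R] [PartialOrder R] [IsOrderedRing R]

theorem mulVec_nonneg {M : Matrix κ ι R} (hM : ∀ i j, 0 ≤ M i j) {x : ι → R} (hx : 0 ≤ x) :
    0 ≤ M *ᵥ x := fun i =>
  Finset.sum_nonneg fun j _ => mul_nonneg (hM i j) (hx j)

theorem mulVec_mono {M : Matrix κ ι R} (hM : ∀ i j, 0 ≤ M i j) : Monotone (M *ᵥ ·) :=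
  fun _ _ hxy i => Finset.sum_le_sum fun j _ => mul_le_mul_of_nonneg_left (hxy j) (hM i j)

/-- A vector showing that the Metzler matrix `M` is Hurwitz: it is positive and `M` maps it to a
negative vector. -/
structure IsStabilityCertificate (M : Matrix ι ι R) (η : ι → R) : Prop where
  pos : ∀ i, 0 < η i
  mulVec_neg : ∀ i, (M *ᵥ η) i < 0

theorem IsMetzler.mulVec_apply_le {M : Matrix ι ι R} (hM : IsMetzler M) {x y : ι → R}
    (hxy : x ≤ y) {i : ι} (hi : x i = y i) : (M *ᵥ x) i ≤ (M *ᵥ y) i := by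
  refine Finset.sum_le_sum fun j _ => ?_
  rcases eq_or_ne i j with rfl | hij
  · rw [hi]
  · exact mul_le_mul_of_nonneg_left (hxy j) (hM hij)

theorem IsMetzler.mulVec_apply_nonneg {M : Matrix ι ι R} (hM : IsMetzler M) {y : ι → R}
    (hy : 0 ≤ y) {i : ι} (hi : y i = 0) : 0 ≤ (M *ᵥ y) i := by
  simpa using hM.mulVec_apply_le hy hi.symm

theorem IsMetzler.isStabilityCertificate {M : Matrix ι ι R} (hM : IsMetzler M) {η : ι → R}
    (hη : 0 ≤ η) (hMη : ∀ i, (M *ᵥ η) i < 0) : IsStabilityCertificate M η :=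
  ⟨fun i => (hη i).lt_of_ne fun h => (hMη i).not_ge (hM.mulVec_apply_nonneg hη h.symm), hMη⟩

end OrderedSemiring

section OrderedField

variable [Field R] [LinearOrder R] [IsStrictOrderedRing R] {M : Matrix ι ι R} {η : ι → R}

theorem IsMetzler.nonneg_of_mulVec_nonpos (hM : IsMetzler M) (h : IsStabilityCertificate M η)
    {x : ι → R} (hx : M *ᵥ x ≤ 0) : 0 ≤ x := by
  by_contra hneg
  obtain ⟨i, hi⟩ : ∃ i, x i < 0 := by simpa [Pi.le_def] using hneg
  obtain ⟨j, -, hmin⟩ := Finset.univ.exists_min_image (fun i => x i / η i) ⟨i, Finset.mem_univ i⟩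
  set q := x j / η j
  have hq : q < 0 := (hmin i (Finset.mem_univ i)).trans_lt (div_neg_of_neg_of_pos hi (h.pos i))
  have hy : 0 ≤ x - q • η := fun l =>
    sub_nonneg.2 <| (le_div_iff₀ (h.pos l)).1 (hmin l (Finset.mem_univ l))
  have hyj : (x - q • η) j = 0 := sub_eq_zero.2 (div_mul_cancel₀ _ (h.pos j).ne').symm
  have hle : q * (M *ᵥ η) j ≤ (M *ᵥ x) j := by
    simpa [Matrix.mulVec_sub, Matrix.mulVec_smul] using hM.mulVec_apply_nonneg hy hyj
  exact (mul_pos_of_neg_of_neg hq (h.mulVec_neg j)).not_ge (hle.trans (hx j))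

variable [DecidableEq ι]

theorem IsMetzler.isUnit (hM : IsMetzler M) (h : IsStabilityCertificate M η) : IsUnit M := by
  rw [← Matrix.mulVec_injective_iff_isUnit, ← Matrix.coe_mulVecLin, injective_iff_map_eq_zero]
  intro x hx
  rw [Matrix.mulVecLin_apply] at hx
  have hneg : 0 ≤ -x := hM.nonneg_of_mulVec_nonpos h (by rw [Matrix.mulVec_neg, hx, neg_zero])
  exact le_antisymm (neg_nonneg.1 hneg) (hM.nonneg_of_mulVec_nonpos h hx.le)

theorem IsMetzler.neg_inv_nonneg (hM : IsMetzler M) (h : IsStabilityCertificate M η) (i j : ι) :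
    0 ≤ (-M⁻¹) i j := by
  have hcol : 0 ≤ -M⁻¹ *ᵥ Pi.single j 1 := by
    refine hM.nonneg_of_mulVec_nonpos h ?_
    rw [mulVec_neg_inv_mulVec (hM.isUnit h), neg_nonpos]
    exact Pi.single_nonneg.2 zero_le_one
  simpa using hcol i

omit [DecidableEq ι] in
theorem IsMetzler.exists_isStabilityCertificate_transpose (hM : IsMetzler M)
    (h : IsStabilityCertificate M η) : ∃ ξ, IsStabilityCertificate Mᵀ ξ := by
  classical
  have hnonneg : 0 ≤ -(Mᵀ)⁻¹ *ᵥ 1 := by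
    rw [← Matrix.transpose_nonsing_inv, ← Matrix.transpose_neg]
    exact mulVec_nonneg (fun i j => hM.neg_inv_nonneg h j i) zero_le_one
  refine ⟨_, hM.transpose.isStabilityCertificate hnonneg fun i => ?_⟩
  rw [mulVec_neg_inv_mulVec ((Matrix.isUnit_transpose M).2 (hM.isUnit h))]
  simp

end OrderedField

variable [DecidableEq ι]

theorem continuousAt_neg_inv_mulVec {C : ℝ → Matrix ι ι ℝ} {u : ℝ} (hC : ContinuousAt C u)
    (hu : IsUnit (C u)) (v : ι → ℝ) : ContinuousAt (fun s => -(C s)⁻¹ *ᵥ v) u := by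
  have hinv : ContinuousAt (fun s => (C s)⁻¹) u := by
    refine (continuousAt_matrix_inv (C u) ?_).comp hC
    rw [Ring.inverse_eq_inv']
    exact continuousAt_inv₀ ((Matrix.isUnit_iff_isUnit_det _).1 hu).ne_zero
  have hmulVec : Continuous fun M : Matrix ι ι ℝ => -M *ᵥ v :=
    continuous_neg.matrix_mulVec continuous_const
  exact hmulVec.continuousAt.comp hinv

theorem exists_isStabilityCertificate_of_path {C : ℝ → Matrix ι ι ℝ} {T : ℝ}
    (hcont : Continuous C) (hT : 0 ≤ T) (hC : ∀ u ∈ Set.Icc 0 T, IsMetzler (C u))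
    (hunit : ∀ u ∈ Set.Icc 0 T, IsUnit (C u)) {η : ι → ℝ} (h₀ : IsStabilityCertificate (C 0) η) :
    ∃ ζ, IsStabilityCertificate (C T) ζ := by
  set ζ : ℝ → ι → ℝ := fun u => -(C u)⁻¹ *ᵥ 1
  have hζ : ∀ u ∈ Set.Icc 0 T, C u *ᵥ ζ u = -1 := fun u hu => mulVec_neg_inv_mulVec (hunit u hu) 1
  have hcontζ : ∀ u ∈ Set.Icc 0 T, ContinuousAt ζ u := fun u hu =>
    continuousAt_neg_inv_mulVec hcont.continuousAt (hunit u hu) 1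
  have hcert : ∀ u ∈ Set.Icc 0 T, 0 ≤ ζ u → IsStabilityCertificate (C u) (ζ u) := fun u hu h =>
    (hC u hu).isStabilityCertificate h (by simp [hζ u hu])
  -- `ζ u ≥ 0` is a closed condition on `u`, and it is open because it forces `ζ u > 0`.
  have hnonneg : Set.Icc 0 T ⊆ {u | 0 ≤ ζ u} := by
    refine IsClosed.Icc_subset_of_forall_mem_nhdsWithin ?_ ?_ ?_
    · rw [Set.inter_comm]
      exact ContinuousOn.preimage_isClosed_of_isClosed
        (fun u hu => (hcontζ u hu).continuousWithinAt) isClosed_Icc isClosed_Ici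
    · have h0 : (0 : ℝ) ∈ Set.Icc 0 T := ⟨le_rfl, hT⟩
      refine (hC 0 h0).nonneg_of_mulVec_nonpos h₀ ?_
      rw [hζ 0 h0]
      exact neg_nonpos.2 zero_le_one
    · rintro u ⟨hu, hu0, huT⟩
      have hpos : ∀ i, ∀ᶠ v in 𝓝 u, 0 < ζ v i := fun i =>
        (tendsto_pi_nhds.1 (hcontζ u ⟨hu0, huT.le⟩) i).eventually_const_lt
          ((hcert u ⟨hu0, huT.le⟩ hu).pos i)
      refine mem_nhdsWithin_of_mem_nhds ?_
      filter_upwards [eventually_all.2 hpos] with v hv i using (hv i).le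
  have hTmem : T ∈ Set.Icc 0 T := ⟨hT, le_rfl⟩
  exact ⟨ζ T, hcert T hTmem (hnonneg hTmem)⟩

end Metzler

/-! ### Hurwitz matrices and the spectral radius -/

section Spectral

variable {n : ℕ}

theorem isUnit_toC_iff {M : Matrix (Fin n) (Fin n) ℝ} : IsUnit (toC M) ↔ IsUnit M := by
  have hdet : (toC M).det = ((M.det : ℝ) : ℂ) := (RingHom.map_det Complex.ofRealHom M).symm
  rw [Matrix.isUnit_iff_isUnit_det, Matrix.isUnit_iff_isUnit_det, hdet, isUnit_iff_ne_zero,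
    isUnit_iff_ne_zero, Complex.ofReal_ne_zero]

theorem toC_smul_one_sub (s : ℝ) (M : Matrix (Fin n) (Fin n) ℝ) :
    toC (s • (1 : Matrix (Fin n) (Fin n) ℝ) - M)
      = algebraMap ℂ (Matrix (Fin n) (Fin n) ℂ) s - toC M := by
  ext i j
  rcases eq_or_ne i j with rfl | hij <;> simp [Matrix.algebraMap_matrix_apply, *]

theorem IsHurwitz.isUnit_smul_one_sub {M : Matrix (Fin n) (Fin n) ℝ} (hM : IsHurwitz M) {s : ℝ}
    (hs : 0 ≤ s) : IsUnit (s • (1 : Matrix (Fin n) (Fin n) ℝ) - M) := by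
  rw [← isUnit_toC_iff, toC_smul_one_sub, ← spectrum.notMem_iff]
  exact fun hmem => (hM s hmem).not_ge (by simpa using hs)

theorem IsHurwitz.isUnit {M : Matrix (Fin n) (Fin n) ℝ} (hM : IsHurwitz M) : IsUnit M := by
  simpa using hM.isUnit_smul_one_sub le_rfl

theorem isUnit_smul_one_sub_of_specRad_lt {R : Matrix (Fin n) (Fin n) ℝ} {s : ℝ}
    (hs : specRad R < ‖s‖₊) : IsUnit (s • (1 : Matrix (Fin n) (Fin n) ℝ) - R) := by
  rw [← isUnit_toC_iff, toC_smul_one_sub, ← spectrum.notMem_iff]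
  intro hmem
  refine hs.not_ge (le_of_eq_of_le ?_ (le_iSup₂ (s : ℂ) hmem))
  rw [Complex.nnnorm_real]

theorem isUnit_one_sub_smul_of_specRad_lt_one {R : Matrix (Fin n) (Fin n) ℝ} (hR : specRad R < 1)
    {u : ℝ} (hu : u ∈ Set.Icc (0 : ℝ) 1) : IsUnit (1 - u • R) := by
  rcases hu.1.eq_or_lt with rfl | hpos
  · simp
  have hinv : (1 : ENNReal) ≤ ‖u⁻¹‖₊ := by
    rw [ENNReal.one_le_coe_iff, ← NNReal.coe_le_coe, coe_nnnorm,
      Real.norm_of_nonneg (by positivity)]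
    exact (one_le_inv₀ hpos).2 hu.2
  have hunit := isUnit_smul_one_sub_of_specRad_lt (hR.trans_le hinv)
  have hsmul : 1 - u • R = Units.mk0 u hpos.ne' • (u⁻¹ • (1 : Matrix (Fin n) (Fin n) ℝ) - R) := by
    rw [Units.smul_mk0, smul_sub, smul_inv_smul₀ hpos.ne']
  rw [hsmul]
  exact hunit.smul _

theorem isUnit_one_sub_of_specRad_lt_one {R : Matrix (Fin n) (Fin n) ℝ} (hR : specRad R < 1) :
    IsUnit (1 - R) := by
  simpa using isUnit_one_sub_smul_of_specRad_lt_one hR (u := 1) ⟨zero_le_one, le_rfl⟩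

theorem IsHurwitz.exists_isStabilityCertificate {M : Matrix (Fin n) (Fin n) ℝ} (hM : IsHurwitz M)
    (hM' : IsMetzler M) : ∃ η, IsStabilityCertificate M η := by
  obtain ⟨s, hs, hlt⟩ : ∃ s, 0 ≤ s ∧ ∀ i, (M *ᵥ 1) i < s := by
    refine ⟨1 + ∑ i, |(M *ᵥ 1) i|, by positivity, fun i => ?_⟩
    have hle := Finset.single_le_sum (f := fun i => |(M *ᵥ 1) i|) (fun _ _ => abs_nonneg _)
      (Finset.mem_univ i)
    linarith [le_abs_self ((M *ᵥ 1) i)]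
  have hpath := exists_isStabilityCertificate_of_path
    (C := fun u => M - (s - u) • (1 : Matrix (Fin n) (Fin n) ℝ)) (by fun_prop) hs ?_ ?_ (η := 1)
    ⟨fun _ => one_pos, fun i => ?_⟩
  · simpa using hpath
  · intro u _ i j hij
    simpa [hij] using hM' hij
  · intro u hu
    simpa using (hM.isUnit_smul_one_sub (sub_nonneg.2 hu.2)).neg
  · simpa [Matrix.sub_mulVec, Matrix.smul_mulVec] using hlt i

end Spectral

section Combined

variable {n : ℕ} {Λ F : Matrix (Fin n) (Fin n) ℝ}

theorem mul_one_sub_smul_Rmat (hΛ : IsUnit Λ) (F : Matrix (Fin n) (Fin n) ℝ) (u : ℝ) :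
    Λ * (1 - u • Rmat Λ F) = Λ + u • F := by
  rw [Rmat, mul_sub, mul_one, mul_smul_comm, neg_mul, mul_neg,
    Matrix.mul_nonsing_inv_cancel_left _ _ ((Matrix.isUnit_iff_isUnit_det _).1 hΛ), smul_neg,
    sub_neg_eq_add]

theorem mul_one_sub_Rmat (hΛ : IsUnit Λ) (F : Matrix (Fin n) (Fin n) ℝ) :
    Λ * (1 - Rmat Λ F) = Λ + F := by
  simpa only [one_smul] using mul_one_sub_smul_Rmat hΛ F 1

theorem exists_isStabilityCertificate_add (hΛ : IsHurwitz Λ) (hΛ' : IsMetzler Λ)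
    (hF : ∀ i j, 0 ≤ F i j) (hR : specRad (Rmat Λ F) < 1) :
    ∃ η, IsStabilityCertificate (Λ + F) η := by
  obtain ⟨η, hη⟩ := hΛ.exists_isStabilityCertificate hΛ'
  have hpath := exists_isStabilityCertificate_of_path (C := fun u => Λ + u • F) (η := η)
    (by fun_prop) zero_le_one ?_ ?_ (by simpa using hη)
  · simpa using hpath
  · exact fun u hu => hΛ'.add fun i j _ => mul_nonneg hu.1 (hF i j)
  · intro u hu
    rw [← mul_one_sub_smul_Rmat hΛ.isUnit]
    exact hΛ.isUnit.mul (isUnit_one_sub_smul_of_specRad_lt_one hR hu)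

theorem bTilde_eq_neg_inv_mulVec (hΛ : IsUnit Λ) (w : Fin n → ℝ) :
    bTilde Λ F w = -(Λ + F)⁻¹ *ᵥ w := by
  rw [bTilde, Matrix.mulVec_mulVec, ← mul_one_sub_Rmat hΛ, Matrix.mul_inv_rev, mul_neg]

theorem bTilde_nonneg (hΛ : IsHurwitz Λ) (hΛ' : IsMetzler Λ) (hF : ∀ i j, 0 ≤ F i j)
    (hR : specRad (Rmat Λ F) < 1) {w : Fin n → ℝ} (hw : 0 ≤ w) : 0 ≤ bTilde Λ F w := by
  obtain ⟨η, hη⟩ := exists_isStabilityCertificate_add hΛ hΛ' hF hR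
  have hmetz : IsMetzler (Λ + F) := hΛ'.add fun i j _ => hF i j
  rw [bTilde_eq_neg_inv_mulVec hΛ.isUnit]
  exact mulVec_nonneg (hmetz.neg_inv_nonneg hη) hw

theorem add_mulVec_bTilde (hΛ : IsUnit Λ) (hR : IsUnit (1 - Rmat Λ F)) (w : Fin n → ℝ) :
    (Λ + F) *ᵥ bTilde Λ F w = -w := by
  have hunit : IsUnit (Λ + F) := mul_one_sub_Rmat hΛ F ▸ hΛ.mul hR
  rw [bTilde_eq_neg_inv_mulVec hΛ, mulVec_neg_inv_mulVec hunit]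

end Combined

section DiagonalStability

variable {ι : Type*} [Fintype ι]

theorem dotProduct_mulVec_mul_eq {S : Matrix ι ι ℝ} (hS : S.IsSymm) (η y : ι → ℝ) :
    (η * y) ⬝ᵥ S *ᵥ (η * y)
      = ∑ i, η i * y i ^ 2 * (S *ᵥ η) i
        - (∑ i, ∑ j, S i j * η i * η j * (y i - y j) ^ 2) / 2 := by
  have hswap : ∑ i, ∑ j, S i j * η i * η j * y j ^ 2 = ∑ i, ∑ j, S i j * η i * η j * y i ^ 2 := by
    rw [Finset.sum_comm]
    refine Finset.sum_congr rfl fun i _ => Finset.sum_congr rfl fun j _ => ?_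
    rw [hS.apply]
    ring
  have hsq : ∑ i, ∑ j, S i j * η i * η j * (y i - y j) ^ 2
      = ∑ i, ∑ j, S i j * η i * η j * y i ^ 2 + ∑ i, ∑ j, S i j * η i * η j * y j ^ 2
        - 2 * ∑ i, ∑ j, S i j * η i * η j * (y i * y j) := by
    simp only [Finset.mul_sum, ← Finset.sum_add_distrib, ← Finset.sum_sub_distrib]
    exact Finset.sum_congr rfl fun i _ => Finset.sum_congr rfl fun j _ => by ring
  have hlhs : (η * y) ⬝ᵥ S *ᵥ (η * y) = ∑ i, ∑ j, S i j * η i * η j * (y i * y j) := by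
    simp only [dotProduct, Matrix.mulVec, Finset.mul_sum, Pi.mul_apply]
    exact Finset.sum_congr rfl fun i _ => Finset.sum_congr rfl fun j _ => by ring
  have hdiag : ∑ i, η i * y i ^ 2 * (S *ᵥ η) i = ∑ i, ∑ j, S i j * η i * η j * y i ^ 2 := by
    simp only [dotProduct, Matrix.mulVec, Finset.mul_sum]
    exact Finset.sum_congr rfl fun i _ => Finset.sum_congr rfl fun j _ => by ring
  rw [hlhs, hdiag, hsq, hswap]
  ring

theorem IsMetzler.posDef_neg_of_isSymm {S : Matrix ι ι ℝ} (hS : IsMetzler S) (hsymm : S.IsSymm)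
    {η : ι → ℝ} (h : IsStabilityCertificate S η) : (-S).PosDef := by
  refine Matrix.PosDef.of_dotProduct_mulVec_pos (by simpa [Matrix.IsHermitian] using hsymm.eq) ?_
  intro x hx
  obtain ⟨y, rfl⟩ : ∃ y, x = η * y :=
    ⟨x / η, funext fun i => (mul_div_cancel₀ _ (h.pos i).ne').symm⟩
  obtain ⟨i, hi⟩ := Function.ne_iff.1 (right_ne_zero_of_mul hx)
  have hneg : ∑ i, η i * y i ^ 2 * (S *ᵥ η) i < 0 := by
    refine Finset.sum_neg' (fun j _ => ?_) ⟨i, Finset.mem_univ i, ?_⟩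
    · exact mul_nonpos_of_nonneg_of_nonpos (mul_nonneg (h.pos j).le (sq_nonneg _))
        (h.mulVec_neg j).le
    · exact mul_neg_of_pos_of_neg (mul_pos (h.pos i) (sq_pos_of_ne_zero hi)) (h.mulVec_neg i)
  have hnonneg : 0 ≤ ∑ i, ∑ j, S i j * η i * η j * (y i - y j) ^ 2 := by
    refine Finset.sum_nonneg fun i _ => Finset.sum_nonneg fun j _ => ?_
    rcases eq_or_ne i j with rfl | hij
    · simp
    · have := h.pos i
      have := h.pos j
      have := hS hij
      positivity
  rw [star_trivial, Matrix.neg_mulVec, dotProduct_neg, dotProduct_mulVec_mul_eq hsymm]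
  linarith

theorem IsMetzler.exists_isDiagLyap {n : ℕ} {M : Matrix (Fin n) (Fin n) ℝ} (hM : IsMetzler M)
    {η : Fin n → ℝ} (h : IsStabilityCertificate M η) : ∃ D, IsDiagLyap M D := by
  obtain ⟨ξ, hξ⟩ := hM.exists_isStabilityCertificate_transpose h
  set d : Fin n → ℝ := ξ / η
  have hd : ∀ i, 0 < d i := fun i => div_pos (hξ.pos i) (h.pos i)
  have hdη : Matrix.diagonal d *ᵥ η = ξ := by
    ext i
    rw [Matrix.mulVec_diagonal]
    exact div_mul_cancel₀ _ (h.pos i).ne'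
  refine ⟨Matrix.diagonal d, Matrix.isDiag_diagonal d, Matrix.PosDef.diagonal hd, ?_⟩
  refine IsMetzler.posDef_neg_of_isSymm (η := η) ?_ ?_ ⟨h.pos, fun i => ?_⟩
  · intro i j hij
    simpa using add_nonneg (mul_nonneg (hM hij.symm) (hd j).le) (mul_nonneg (hd i).le (hM hij))
  · rw [Matrix.IsSymm, Matrix.transpose_add, Matrix.transpose_mul, Matrix.transpose_mul,
      Matrix.diagonal_transpose, Matrix.transpose_transpose, add_comm]
  · rw [Matrix.add_mulVec, ← Matrix.mulVec_mulVec, hdη, ← Matrix.mulVec_mulVec, Pi.add_apply,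
      Matrix.mulVec_diagonal]
    exact add_neg (hξ.mulVec_neg i) (mul_neg_of_pos_of_neg (hd i) (h.mulVec_neg i))

end DiagonalStability

/-! ### Delay differential inequalities -/

section DecayBarrier

variable {ι : Type*} {b η : ι → ℝ} {r T : ℝ}

/-- The decaying upper barrier `b + exp (-r (t - T)) η`. -/
noncomputable def decayBarrier (b η : ι → ℝ) (r T t : ℝ) : ι → ℝ :=
  b + Real.exp (-(r * (t - T))) • η

theorem continuous_decayBarrier (b η : ι → ℝ) (r T : ℝ) : Continuous (decayBarrier b η r T) := by
  unfold decayBarrier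
  fun_prop

theorem decayBarrier_sub_le (hη : 0 ≤ η) (t s : ℝ) (j : ι) :
    decayBarrier b η r T t j - r * Real.exp (-(r * (t - T))) * η j * (s - t)
      ≤ decayBarrier b η r T s j := by
  have htangent : Real.exp (-(r * (t - T))) * (1 - r * (s - t)) ≤ Real.exp (-(r * (s - T))) := by
    rw [show -(r * (s - T)) = -(r * (t - T)) + -(r * (s - t)) by ring, Real.exp_add]
    exact mul_le_mul_of_nonneg_left (by linarith [Real.add_one_le_exp (-(r * (s - t)))])
      (Real.exp_pos _).le
  have hmul := mul_le_mul_of_nonneg_right htangent (hη j)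
  simp only [decayBarrier, Pi.add_apply, Pi.smul_apply, smul_eq_mul]
  linarith

theorem le_decayBarrier_of_le (hr : 0 ≤ r) (hη : 0 ≤ η) {x : ι → ℝ} (hx : x ≤ b + η)
    {t : ℝ} (ht : t ≤ T) : x ≤ decayBarrier b η r T t := by
  have hexp : 1 ≤ Real.exp (-(r * (t - T))) :=
    Real.one_le_exp (neg_nonneg.2 (mul_nonpos_of_nonneg_of_nonpos hr (sub_nonpos.2 ht)))
  exact hx.trans (add_le_add_right (le_smul_of_one_le_left hη hexp) b)

theorem decayBarrier_le (hr : 0 ≤ r) (hη : 0 ≤ η) {t : ℝ} (ht : T ≤ t) :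
    decayBarrier b η r T t ≤ b + η := by
  have hexp : Real.exp (-(r * (t - T))) ≤ 1 :=
    Real.exp_le_one_iff.2 (neg_nonpos.2 (mul_nonneg hr (sub_nonneg.2 ht)))
  exact add_le_add_right (smul_le_of_le_one_left hη hexp) b

theorem tendsto_decayBarrier (hr : 0 < r) (b η : ι → ℝ) (T : ℝ) :
    Tendsto (decayBarrier b η r T) atTop (𝓝 b) := by
  have hlin : Tendsto (fun t => r * (t - T)) atTop atTop :=
    (tendsto_atTop_add_const_right _ (-T) tendsto_id).const_mul_atTop hr
  unfold decayBarrier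
  simpa using
    tendsto_const_nhds.add ((Real.tendsto_exp_neg_atTop_nhds_zero.comp hlin).smul_const η)

end DecayBarrier

section DelaySubsolution

variable {ι : Type*} [Fintype ι]

/-- The nonnegative function `u` satisfies the delay differential inequality
`D⁺u(t) ≤ Λ u(t) + φ(max_{t-τ ≤ s ≤ t} u(s))` for `t ≥ T`. The Dini derivative is encoded by its
strict upper bounds `m`, the maximum by its strict upper bounds `c`, and a component is only
constrained where it is positive, since a norm need not be differentiable at a zero. -/
structure IsDelaySubsolution (Λ : Matrix ι ι ℝ) (φ : (ι → ℝ) → ι → ℝ) (τ T : ℝ)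
    (u : ℝ → ι → ℝ) : Prop where
  nonneg : ∀ t, 0 ≤ u t
  continuousOn : ContinuousOn u (Set.Ici (T - τ))
  eventually_le : ∀ t, T ≤ t → ∀ j, 0 < u t j →
    ∀ c, (∀ s ∈ Set.Icc (t - τ) t, ∀ i, u s i < c i) →
    ∀ m, (Λ *ᵥ u t) j + φ c j < m → ∀ᶠ s in 𝓝[>] t, u s j ≤ u t j + m * (s - t)

/-- The positive vector `η` decays at rate `r` under `Λ` and the delayed gain `F`, where `μ` bounds
the growth of `exp (-r t)` backwards over the delay. -/
structure IsDecayRate (Λ F : Matrix ι ι ℝ) (τ : ℝ) (η : ι → ℝ) (r μ : ℝ) : Prop where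
  pos : ∀ i, 0 < η i
  rate_pos : 0 < r
  exp_lt : Real.exp (r * τ) < μ
  mulVec_neg : ∀ i, (Λ *ᵥ η) i + μ * (F *ᵥ η) i + r * η i < 0

variable {Λ F : Matrix ι ι ℝ} {φ φ' : (ι → ℝ) → ι → ℝ} {w b η : ι → ℝ} {τ T T' r μ : ℝ}
  {u : ℝ → ι → ℝ}

theorem IsDelaySubsolution.mono (h : IsDelaySubsolution Λ φ τ T u) (hτ : 0 ≤ τ)
    (hφ : ∀ c, 0 ≤ c → φ c ≤ φ' c) : IsDelaySubsolution Λ φ' τ T u where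
  nonneg := h.nonneg
  continuousOn := h.continuousOn
  eventually_le t ht j hj c hc m hm := by
    have hc0 : 0 ≤ c := (h.nonneg t).trans fun i => (hc t ⟨by linarith, le_rfl⟩ i).le
    exact h.eventually_le t ht j hj c hc m (by linarith [hφ c hc0 j])

theorem IsDelaySubsolution.restart (h : IsDelaySubsolution Λ φ τ T u) (hT : T ≤ T') :
    IsDelaySubsolution Λ φ τ T' u where
  nonneg := h.nonneg
  continuousOn := h.continuousOn.mono (Set.Ici_subset_Ici.2 (sub_le_sub_right hT τ))
  eventually_le t ht := h.eventually_le t (hT.trans ht)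

theorem IsDelaySubsolution.freeze (h : IsDelaySubsolution Λ φ τ T u) {c : ι → ℝ}
    (hc : ∀ s, T - τ ≤ s → ∀ i, u s i < c i) : IsDelaySubsolution Λ (fun _ => φ c) τ T u where
  nonneg := h.nonneg
  continuousOn := h.continuousOn
  eventually_le t ht j hj _ _ :=
    h.eventually_le t ht j hj c fun s hs => hc s ((sub_le_sub_right ht τ).trans hs.1)

theorem IsDecayRate.smul (h : IsDecayRate Λ F τ η r μ) {κ : ℝ} (hκ : 0 < κ) :
    IsDecayRate Λ F τ (κ • η) r μ where
  pos i := mul_pos hκ (h.pos i)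
  rate_pos := h.rate_pos
  exp_lt := h.exp_lt
  mulVec_neg i := by
    have hneg := mul_neg_of_pos_of_neg hκ (h.mulVec_neg i)
    simp only [Matrix.mulVec_smul, Pi.smul_apply, smul_eq_mul]
    linarith

theorem IsStabilityCertificate.exists_isDecayRate (h : IsStabilityCertificate (Λ + F) η) (τ : ℝ) :
    ∃ r μ, IsDecayRate Λ F τ η r μ := by
  have hsmall : ∀ i, ∀ᶠ r : ℝ in 𝓝 0,
      (Λ *ᵥ η) i + (Real.exp (r * τ) + r) * (F *ᵥ η) i + r * η i < 0 := fun i => by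
    have hcont : Continuous fun r : ℝ =>
        (Λ *ᵥ η) i + (Real.exp (r * τ) + r) * (F *ᵥ η) i + r * η i := by fun_prop
    refine hcont.continuousAt.eventually_lt_const ?_
    simpa [Matrix.add_mulVec] using h.mulVec_neg i
  obtain ⟨r, hr, hr0⟩ :=
    (((eventually_all.2 hsmall).filter_mono nhdsWithin_le_nhds).and
      (self_mem_nhdsWithin (s := Set.Ioi (0 : ℝ)))).exists
  exact ⟨r, Real.exp (r * τ) + r, h.pos, hr0, lt_add_of_pos_right _ hr0, hr⟩

theorem IsDecayRate.decayBarrier_lt (h : IsDecayRate Λ F τ η r μ) {s t : ℝ} (hs : t - τ ≤ s)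
    (i : ι) : decayBarrier b η r T s i < (b + (μ * Real.exp (-(r * (t - T)))) • η) i := by
  have hexp : Real.exp (-(r * (s - T))) < μ * Real.exp (-(r * (t - T))) := calc
    Real.exp (-(r * (s - T))) ≤ Real.exp (r * τ) * Real.exp (-(r * (t - T))) := by
      rw [← Real.exp_add, Real.exp_le_exp]
      nlinarith [mul_nonneg h.rate_pos.le (sub_nonneg.2 hs)]
    _ < μ * Real.exp (-(r * (t - T))) := mul_lt_mul_of_pos_right h.exp_lt (Real.exp_pos _)
  exact add_lt_add_right (mul_lt_mul_of_pos_right hexp (h.pos i)) _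

theorem IsDecayRate.mulVec_decayBarrier_lt (h : IsDecayRate Λ F τ η r μ)
    (hb : (Λ + F) *ᵥ b ≤ -w) (t : ℝ) (j : ι) :
    (Λ *ᵥ decayBarrier b η r T t) j + (F *ᵥ (b + (μ * Real.exp (-(r * (t - T)))) • η) + w) j
      < -(r * Real.exp (-(r * (t - T))) * η j) := by
  have hbj := hb j
  have hηj := mul_neg_of_pos_of_neg (Real.exp_pos (-(r * (t - T)))) (h.mulVec_neg j)
  simp only [decayBarrier, Matrix.add_mulVec, Matrix.mulVec_add, Matrix.mulVec_smul, Pi.add_apply,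
    Pi.smul_apply, Pi.neg_apply, smul_eq_mul] at hbj ⊢
  linarith

theorem IsDelaySubsolution.eventually_le_decayBarrier
    (h : IsDelaySubsolution Λ (fun c => F *ᵥ c + w) τ T u) (hτ : 0 ≤ τ) (hΛ : IsMetzler Λ)
    (hb : 0 ≤ b) (hΛb : (Λ + F) *ᵥ b ≤ -w) (hη : IsDecayRate Λ F τ η r μ) {t : ℝ} (ht : T ≤ t)
    (hle : ∀ s ∈ Set.Icc (T - τ) t, u s ≤ decayBarrier b η r T s) :
    ∀ᶠ s in 𝓝[>] t, u s ≤ decayBarrier b η r T s := by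
  refine eventually_all.2 fun j => ?_
  have hut := hle t ⟨by linarith, le_rfl⟩
  rcases (hut j).lt_or_eq with hlt | heq
  · have hcont : ContinuousWithinAt u (Set.Ioi t) t :=
      (h.continuousOn t (show T - τ ≤ t by linarith)).mono
        fun s (hs : t < s) => show T - τ ≤ s by linarith
    exact ((tendsto_pi_nhds.1 hcont j).eventually_lt
      (tendsto_pi_nhds.1 (continuous_decayBarrier b η r T).continuousWithinAt j) hlt).mono
        fun s hs => hs.le
  · have hpos : 0 < u t j := heq ▸
      add_pos_of_nonneg_of_pos (hb j) (mul_pos (Real.exp_pos _) (hη.pos j))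
    have hslope : (Λ *ᵥ u t) j + (F *ᵥ (b + (μ * Real.exp (-(r * (t - T)))) • η) + w) j
        < -(r * Real.exp (-(r * (t - T))) * η j) :=
      (add_le_add_left (hΛ.mulVec_apply_le hut heq) _).trans_lt
        (hη.mulVec_decayBarrier_lt hΛb t j)
    refine (h.eventually_le t ht j hpos _ (fun s hs i => ?_) _ hslope).mono fun s hs => ?_
    · exact (hle s ⟨by linarith [hs.1], hs.2⟩ i).trans_lt (hη.decayBarrier_lt hs.1 i)
    · rw [heq, neg_mul, ← sub_eq_add_neg] at hs
      exact hs.trans (decayBarrier_sub_le (fun i => (hη.pos i).le) t s j)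

theorem IsDelaySubsolution.le_decayBarrier
    (h : IsDelaySubsolution Λ (fun c => F *ᵥ c + w) τ T u) (hτ : 0 ≤ τ) (hΛ : IsMetzler Λ)
    (hb : 0 ≤ b) (hΛb : (Λ + F) *ᵥ b ≤ -w) (hη : IsDecayRate Λ F τ η r μ)
    (hle : ∀ s ∈ Set.Icc (T - τ) T, u s ≤ decayBarrier b η r T s) {t : ℝ} (ht : T ≤ t) :
    u t ≤ decayBarrier b η r T t := by
  have hsub : Set.Icc T t ⊆ {s | u s ≤ decayBarrier b η r T s} := by
    refine IsClosed.Icc_subset_of_forall_mem_nhdsGT_of_Icc_subset ?_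
      (hle T ⟨by linarith, le_rfl⟩) fun s hs hI => ?_
    · rw [Set.inter_comm]
      exact isClosed_Icc.isClosed_le
        (h.continuousOn.mono fun s hs => show T - τ ≤ s by linarith [hs.1])
        (continuous_decayBarrier b η r T).continuousOn
    · refine h.eventually_le_decayBarrier hτ hΛ hb hΛb hη hs.1 fun v hv => ?_
      rcases le_total v T with hvT | hvT
      · exact hle v ⟨hv.1, hvT⟩
      · exact hI ⟨hvT, hv.2⟩
  exact hsub ⟨ht, le_rfl⟩

theorem IsDelaySubsolution.le_of_le
    (h : IsDelaySubsolution Λ (fun c => F *ᵥ c + w) τ T u) (hτ : 0 ≤ τ) (hΛ : IsMetzler Λ)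
    (hb : 0 ≤ b) (hΛb : (Λ + F) *ᵥ b ≤ -w) (hη : IsStabilityCertificate (Λ + F) η)
    (hle : ∀ s ∈ Set.Icc (T - τ) T, u s ≤ b) {t : ℝ} (ht : T ≤ t) : u t ≤ b := by
  obtain ⟨r, μ, hr⟩ := hη.exists_isDecayRate τ
  have hbound : ∀ᶠ κ in 𝓝[>] (0 : ℝ), u t ≤ b + κ • η := by
    filter_upwards [self_mem_nhdsWithin] with κ hκ
    have hκη := hr.smul hκ
    have hnonneg : 0 ≤ κ • η := fun i => (hκη.pos i).le
    exact (h.le_decayBarrier hτ hΛ hb hΛb hκη (fun s hs => le_decayBarrier_of_le hr.rate_pos.le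
      hnonneg ((hle s hs).trans (le_add_of_nonneg_right hnonneg)) hs.2) ht).trans
        (decayBarrier_le hr.rate_pos.le hnonneg ht)
  have hlim : Tendsto (fun κ : ℝ => b + κ • η) (𝓝[>] 0) (𝓝 b) := by
    have hcont : Continuous fun κ : ℝ => b + κ • η := by fun_prop
    simpa using (hcont.tendsto 0).mono_left nhdsWithin_le_nhds
  exact ge_of_tendsto hlim hbound

omit [Fintype ι] in
theorem exists_pos_forall_le_smul [Finite ι] {K : Set ℝ} (hK : IsCompact K)
    (hu : ContinuousOn u K) (hη : ∀ i, 0 < η i) : ∃ κ : ℝ, 0 < κ ∧ ∀ s ∈ K, u s ≤ κ • η := by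
  have hbdd : ∀ i, ∃ q : ℝ, ∀ s ∈ K, u s i / η i ≤ q := fun i => by
    have hcont : ContinuousOn (fun s => u s i / η i) K :=
      (continuousOn_pi.1 hu i).div_const (η i)
    obtain ⟨q, hq⟩ := (hK.image_of_continuousOn hcont).bddAbove
    exact ⟨q, fun s hs => hq ⟨s, hs, rfl⟩⟩
  choose q hq using hbdd
  have := Fintype.ofFinite ι
  refine ⟨1 + ∑ i, |q i|, by positivity, fun s hs i => ?_⟩
  have hsum := Finset.single_le_sum (f := fun i => |q i|) (fun _ _ => abs_nonneg _)
    (Finset.mem_univ i)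
  exact (div_le_iff₀ (hη i)).1 (by linarith [hq i s hs, le_abs_self (q i)])

theorem IsDelaySubsolution.eventually_le_add
    (h : IsDelaySubsolution Λ (fun c => F *ᵥ c + w) τ T u) (hτ : 0 ≤ τ) (hΛ : IsMetzler Λ)
    (hb : 0 ≤ b) (hΛb : (Λ + F) *ᵥ b ≤ -w) (hη : IsStabilityCertificate (Λ + F) η) (j : ι)
    {ε : ℝ} (hε : 0 < ε) : ∀ᶠ t in atTop, u t j ≤ b j + ε := by
  obtain ⟨r, μ, hr⟩ := hη.exists_isDecayRate τ
  obtain ⟨κ, hκ, hu⟩ := exists_pos_forall_le_smul (isCompact_Icc (a := T - τ) (b := T))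
    (h.continuousOn.mono Set.Icc_subset_Ici_self) hr.pos
  have hκη := hr.smul hκ
  have hbound : ∀ t, T ≤ t → u t ≤ decayBarrier b (κ • η) r T t := fun t =>
    h.le_decayBarrier hτ hΛ hb hΛb hκη fun s hs => le_decayBarrier_of_le hr.rate_pos.le
      (fun i => (hκη.pos i).le) ((hu s hs).trans (le_add_of_nonneg_left hb)) hs.2
  filter_upwards [eventually_ge_atTop T, (tendsto_pi_nhds.1
    (tendsto_decayBarrier hr.rate_pos b (κ • η) T) j).eventually_lt_const
      (lt_add_of_pos_right (b j) hε)] with t ht hlt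
  exact (hbound t ht j).trans hlt.le

theorem IsDelaySubsolution.eventually_le_neg_inv_mulVec_add [DecidableEq ι]
    (h : IsDelaySubsolution Λ φ τ T u) (hτ : 0 ≤ τ) (hΛ : IsMetzler Λ)
    (hη : IsStabilityCertificate Λ η) {c : ι → ℝ} (hφc : 0 ≤ φ c)
    (hc : ∀ᶠ t in atTop, ∀ i, u t i < c i) (j : ι) {ε : ℝ} (hε : 0 < ε) :
    ∀ᶠ t in atTop, u t j ≤ (-Λ⁻¹ *ᵥ φ c) j + ε := by
  obtain ⟨T', hT'⟩ := eventually_atTop.1 hc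
  have hfrozen : IsDelaySubsolution Λ (fun d => (0 : Matrix ι ι ℝ) *ᵥ d + φ c) τ
      (max T (T' + τ)) u := by
    simpa using (h.restart (le_max_left T (T' + τ))).freeze fun s hs =>
      hT' s (by linarith [le_max_right T (T' + τ)])
  refine hfrozen.eventually_le_add (η := η) hτ hΛ (mulVec_nonneg (hΛ.neg_inv_nonneg hη) hφc) ?_
    ?_ j hε
  · rw [add_zero, mulVec_neg_inv_mulVec (hΛ.isUnit hη)]
  · rwa [add_zero]

theorem IsDelaySubsolution.eventually_le_neg_inv_mulVec_add_of_continuousOn [DecidableEq ι]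
    (h : IsDelaySubsolution Λ φ τ T u) (hτ : 0 ≤ τ) (hΛ : IsMetzler Λ)
    (hη : IsStabilityCertificate Λ η) (hφ : ∀ c, 0 ≤ c → 0 ≤ φ c)
    (hcont : ContinuousOn φ (Set.Ici 0)) {c : ι → ℝ} (hc0 : 0 ≤ c)
    (hc : ∀ i, ∀ ε > 0, ∀ᶠ t in atTop, u t i ≤ c i + ε) (j : ι) {ε : ℝ} (hε : 0 < ε) :
    ∀ᶠ t in atTop, u t j ≤ (-Λ⁻¹ *ᵥ φ c) j + ε := by
  set c' : ℝ → ι → ℝ := fun κ => c + κ • 1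
  have hc'0 : ∀ κ, 0 < κ → 0 ≤ c' κ := fun κ hκ => add_nonneg hc0 (smul_nonneg hκ.le zero_le_one)
  have hlim : Tendsto (fun κ => (-Λ⁻¹ *ᵥ φ (c' κ)) j) (𝓝[>] 0) (𝓝 ((-Λ⁻¹ *ᵥ φ c) j)) := by
    have hc'lim : Tendsto c' (𝓝[>] 0) (𝓝[Set.Ici 0] c) := by
      refine tendsto_nhdsWithin_iff.2 ⟨?_, eventually_nhdsWithin_of_forall hc'0⟩
      have hc'cont : Continuous c' := by fun_prop
      simpa [c'] using (hc'cont.tendsto 0).mono_left nhdsWithin_le_nhds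
    have hmulVec : Continuous fun v : ι → ℝ => (-Λ⁻¹ *ᵥ v) j := by fun_prop
    exact (hmulVec.tendsto _).comp ((hcont c hc0).tendsto.comp hc'lim)
  obtain ⟨κ, hκlt, hκ⟩ := ((hlim.eventually_lt_const (lt_add_of_pos_right _ (half_pos hε))).and
    (self_mem_nhdsWithin (s := Set.Ioi (0 : ℝ)))).exists
  have hlt : ∀ᶠ t in atTop, ∀ i, u t i < c' κ i := eventually_all.2 fun i =>
    (hc i (κ / 2) (half_pos hκ)).mono fun t ht => by
      simp only [c', Pi.add_apply, Pi.smul_apply, Pi.one_apply, smul_eq_mul, mul_one]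
      linarith [half_lt_self hκ]
  filter_upwards [h.eventually_le_neg_inv_mulVec_add hτ hΛ hη (hφ _ (hc'0 κ hκ)) hlt j
    (half_pos hε)] with t ht
  linarith

end DelaySubsolution

/-! ### Indefinite integrals -/

section IndefiniteIntegral

variable {E : Type*} [NormedAddCommGroup E] [NormedSpace ℝ E] {f x : ℝ → E} {T s t m : ℝ}

theorem absolutelyContinuousOnInterval_of_dist_le_mul {X Y : Type*} [PseudoMetricSpace X]
    [PseudoMetricSpace Y] {f : ℝ → X} {g : ℝ → Y} {a b K : ℝ}
    (hg : AbsolutelyContinuousOnInterval g a b)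
    (hfg : ∀ u ∈ Set.uIcc a b, ∀ v ∈ Set.uIcc a b, dist (f u) (f v) ≤ K * dist (g u) (g v)) :
    AbsolutelyContinuousOnInterval f a b := by
  have hKg := Tendsto.const_mul K hg
  rw [mul_zero] at hKg
  refine squeeze_zero' (Eventually.of_forall fun E => Finset.sum_nonneg fun _ _ => dist_nonneg)
    (eventually_inf_principal.2 <| Eventually.of_forall fun E hE => ?_) hKg
  rw [Finset.mul_sum]
  exact Finset.sum_le_sum fun i hi => hfg _ (hE.1 i hi).1 _ (hE.1 i hi).2

/-- On `[T, ∞)`, `x` is an indefinite Bochner integral of `f`. -/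
structure IsIndefiniteIntegral (f x : ℝ → E) (T : ℝ) : Prop where
  intervalIntegrable_left : ∀ t, T ≤ t → IntervalIntegrable f volume T t
  eq_left_add_integral : ∀ t, T ≤ t → x t = x T + ∫ s in T..t, f s

namespace IsIndefiniteIntegral

theorem intervalIntegrable (h : IsIndefiniteIntegral f x T) (hs : T ≤ s) (hst : s ≤ t) :
    IntervalIntegrable f volume s t :=
  (h.intervalIntegrable_left s hs).symm.trans (h.intervalIntegrable_left t (hs.trans hst))

theorem integral_eq_sub (h : IsIndefiniteIntegral f x T) (hs : T ≤ s) (hst : s ≤ t) :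
    ∫ v in s..t, f v = x t - x s := by
  rw [h.eq_left_add_integral t (hs.trans hst), h.eq_left_add_integral s hs,
    add_sub_add_left_eq_sub, intervalIntegral.integral_interval_sub_left
      (h.intervalIntegrable_left t (hs.trans hst)) (h.intervalIntegrable_left s hs)]

theorem dist_le_integral_norm (h : IsIndefiniteIntegral f x T) (hs : T ≤ s) (hst : s ≤ t) :
    dist (x s) (x t) ≤ ∫ v in s..t, ‖f v‖ := by
  rw [dist_comm, dist_eq_norm, ← h.integral_eq_sub hs hst]
  exact intervalIntegral.norm_integral_le_integral_norm hst

theorem absolutelyContinuousOnInterval (h : IsIndefiniteIntegral f x T) (ht : T ≤ t) :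
    AbsolutelyContinuousOnInterval x T t := by
  have hint := fun u (hu : T ≤ u) => (h.intervalIntegrable_left u hu).norm
  have hN := (hint t ht).absolutelyContinuousOnInterval_intervalIntegral (c := T)
    Set.left_mem_uIcc
  refine absolutelyContinuousOnInterval_of_dist_le_mul (K := 1) hN fun u hu v hv => ?_
  rw [Set.uIcc_of_le ht] at hu hv
  wlog huv : u ≤ v generalizing u v
  · rw [dist_comm, dist_comm (∫ _ in T..u, _)]
    exact this v hv u hu (le_of_not_ge huv)
  rw [one_mul, dist_comm (∫ _ in T..u, _), Real.dist_eq,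
    intervalIntegral.integral_interval_sub_left (hint v hv.1) (hint u hu.1)]
  exact (h.dist_le_integral_norm hu.1 huv).trans (le_abs_self _)

theorem ae_hasDerivAt [CompleteSpace E] (h : IsIndefiniteIntegral f x T) (ht : T ≤ t) :
    ∀ᵐ u, u ∈ Set.Ioo T t → HasDerivAt x (f u) u := by
  filter_upwards [(h.intervalIntegrable_left t ht).ae_hasDerivAt_integral] with u hu hut
  have hut' : u ∈ Set.uIcc T t := Set.Icc_subset_uIcc (Set.Ioo_subset_Icc_self hut)
  refine ((hu hut' T Set.left_mem_uIcc).const_add (x T)).congr_of_eventuallyEq ?_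
  filter_upwards [Ioi_mem_nhds hut.1] with v hv using h.eq_left_add_integral v hv.le

theorem comp_contDiff [CompleteSpace E] (h : IsIndefiniteIntegral f x T) {Φ : E → ℝ}
    (hΦ : ContDiff ℝ 1 Φ) :
    IsIndefiniteIntegral (fun t => fderiv ℝ Φ (x t) (f t)) (fun t => Φ (x t)) T := by
  have hAC : ∀ t, T ≤ t → AbsolutelyContinuousOnInterval (fun t => Φ (x t)) T t := fun t ht => by
    have hx := h.absolutelyContinuousOnInterval ht
    obtain ⟨K, hK⟩ := hΦ.locallyLipschitz.locallyLipschitzOn.exists_lipschitzOnWith_of_compact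
      (isCompact_uIcc.image_of_continuousOn hx.continuousOn)
    exact absolutelyContinuousOnInterval_of_dist_le_mul hx fun u hu v hv =>
      hK.dist_le_mul _ (Set.mem_image_of_mem x hu) _ (Set.mem_image_of_mem x hv)
  have hderiv : ∀ t, T ≤ t → ∀ᵐ u, u ∈ Set.uIoc T t →
      deriv (fun t => Φ (x t)) u = fderiv ℝ Φ (x u) (f u) := fun t ht => by
    filter_upwards [h.ae_hasDerivAt (ht.trans (le_add_of_nonneg_right zero_le_one))] with u hu hut
    rw [Set.uIoc_of_le ht] at hut
    exact ((hΦ.differentiable one_ne_zero _).hasFDerivAt.comp_hasDerivAt u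
      (hu ⟨hut.1, hut.2.trans_lt (lt_add_one t)⟩)).deriv
  refine ⟨fun t ht => ?_, fun t ht => ?_⟩
  · exact (hAC t ht).intervalIntegrable_deriv.congr_ae
      ((ae_restrict_iff' measurableSet_uIoc).2 (hderiv t ht))
  · rw [← intervalIntegral.integral_congr_ae (hderiv t ht), (hAC t ht).integral_deriv_eq_sub,
      add_sub_cancel]

theorem eventually_le_add_mul {g q : ℝ → ℝ} (h : IsIndefiniteIntegral g q T) (ht : T ≤ t)
    (hg : ∀ᶠ v in 𝓝[≥] t, g v ≤ m) : ∀ᶠ s in 𝓝[>] t, q s ≤ q t + m * (s - t) := by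
  obtain ⟨r, hr, hsub⟩ := mem_nhdsGE_iff_exists_Ico_subset.1 hg
  filter_upwards [Ioo_mem_nhdsGT hr] with s hs
  have hle := intervalIntegral.integral_mono_on hs.1.le (h.intervalIntegrable ht hs.1.le)
    intervalIntegrable_const fun v hv => hsub ⟨hv.1, hv.2.trans_lt hs.2⟩
  rw [h.integral_eq_sub ht hs.1.le, intervalIntegral.integral_const, smul_eq_mul] at hle
  linarith

theorem clm_comp {F : Type*} [NormedAddCommGroup F] [NormedSpace ℝ F] [CompleteSpace E]
    [CompleteSpace F] (h : IsIndefiniteIntegral f x T) (L : E →L[ℝ] F) :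
    IsIndefiniteIntegral (fun t => L (f t)) (fun t => L (x t)) T where
  intervalIntegrable_left t ht := by
    have hint := h.intervalIntegrable_left t ht
    exact ⟨L.integrable_comp hint.1, L.integrable_comp hint.2⟩
  eq_left_add_integral t ht := by
    rw [L.intervalIntegral_comp_comm (h.intervalIntegrable_left t ht), ← map_add,
      ← h.eq_left_add_integral t ht]

theorem eventually_norm_le_add_mul {E : Type*} [NormedAddCommGroup E] [InnerProductSpace ℝ E]
    [CompleteSpace E] {f x : ℝ → E} (h : IsIndefiniteIntegral f x T) (ht : T ≤ t)
    (hx : 0 < ‖x t‖) (hf : ∀ᶠ v in 𝓝[≥] t, inner ℝ (x v) (f v) ≤ m * ‖x t‖) :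
    ∀ᶠ s in 𝓝[>] t, ‖x s‖ ≤ ‖x t‖ + m * (s - t) := by
  have hsq := (h.comp_contDiff (contDiff_norm_sq ℝ)).eventually_le_add_mul ht
    (m := 2 * (m * ‖x t‖)) <| hf.mono fun v hv => by
      simpa only [fderiv_norm_sq_apply, smul_apply, innerSL_apply_apply, nsmul_eq_mul,
        Nat.cast_ofNat] using mul_le_mul_of_nonneg_left hv zero_le_two
  have hpos : ∀ᶠ s in 𝓝[>] t, 0 < ‖x t‖ + m * (s - t) := by
    have hcont : Continuous fun s => ‖x t‖ + m * (s - t) := by fun_prop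
    exact nhdsWithin_le_nhds (hcont.continuousAt.eventually (lt_mem_nhds (by simpa using hx)))
  filter_upwards [hsq, hpos] with s hs hs0
  refine le_of_sq_le_sq ?_ hs0.le
  nlinarith [sq_nonneg (m * (s - t))]

end IsIndefiniteIntegral

end IndefiniteIntegral

/-! ### Modal coordinates -/

section Modal

variable {l m n N : ℕ} {k : Fin N → ℕ}

/-- `x ↦ M x` as a real linear map, for a complex matrix `M` and real vectors `x`. With `M = V⁻¹`
its components are the modal coordinates of `x`. -/
noncomputable def modalMap (M : Matrix (Fin m) (Fin n) ℂ) : (Fin n → ℝ) →L[ℝ] (Fin m → ℂ) :=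
  (M.mulVecLin.restrictScalars ℝ).toContinuousLinearMap ∘L
    ContinuousLinearMap.pi fun i => Complex.ofRealCLM ∘L ContinuousLinearMap.proj i

theorem modalMap_apply (M : Matrix (Fin m) (Fin n) ℂ) (x : Fin n → ℝ) :
    modalMap M x = M *ᵥ fun i => (x i : ℂ) :=
  rfl

theorem absMulVec_apply (M : Matrix (Fin m) (Fin n) ℂ) (x : Fin n → ℝ) (j : Fin m) :
    absMulVec M x j = ‖modalMap M x j‖ :=
  rfl

theorem absMulVec_nonneg (M : Matrix (Fin m) (Fin n) ℂ) (x : Fin n → ℝ) : 0 ≤ absMulVec M x :=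
  fun _ => norm_nonneg _

theorem continuous_absMulVec (M : Matrix (Fin m) (Fin n) ℂ) : Continuous (absMulVec M) :=
  continuous_pi fun j => ((continuous_apply j).comp (modalMap M).continuous).norm

theorem modalMap_mulVec (M : Matrix (Fin l) (Fin m) ℂ) (A : Matrix (Fin m) (Fin n) ℝ)
    (x : Fin n → ℝ) : modalMap M (A *ᵥ x) = modalMap (M * toC A) x := by
  rw [modalMap_apply, modalMap_apply, ← Matrix.mulVec_mulVec]
  exact congrArg (M *ᵥ ·) (funext fun i => RingHom.map_mulVec Complex.ofRealHom A x i)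

theorem mulVec_modalMap_inv {V : Matrix (Fin n) (Fin n) ℂ} (hV : IsUnit V) (x : Fin n → ℝ) :
    V *ᵥ modalMap V⁻¹ x = fun i => (x i : ℂ) := by
  rw [modalMap_apply, Matrix.mulVec_mulVec,
    Matrix.mul_nonsing_inv _ ((Matrix.isUnit_iff_isUnit_det _).1 hV), Matrix.one_mulVec]

theorem absMat_nonneg (M : Matrix (Fin m) (Fin n) ℂ) (i : Fin m) (j : Fin n) :
    0 ≤ absMat M i j :=
  norm_nonneg (M i j)

theorem norm_mulVec_le_absMat_mulVec (M : Matrix (Fin m) (Fin n) ℂ) (z : Fin n → ℂ)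
    (i : Fin m) : ‖(M *ᵥ z) i‖ ≤ (absMat M *ᵥ fun j => ‖z j‖) i :=
  (norm_sum_le Finset.univ fun j => M i j * z j).trans_eq <|
    Finset.sum_congr rfl fun j _ => norm_mul (M i j) (z j)

theorem abs_le_absMat_mulVec_absMulVec {V : Matrix (Fin n) (Fin n) ℂ} (hV : IsUnit V)
    (x : Fin n → ℝ) : |x| ≤ absMat V *ᵥ absMulVec V⁻¹ x := fun i => by
  have hle := norm_mulVec_le_absMat_mulVec V (modalMap V⁻¹ x) i
  rwa [mulVec_modalMap_inv hV, Complex.norm_real] at hle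

theorem inner_mulVec_le_norm_mul_metzlerOf (B : Matrix (Fin n) (Fin n) ℂ) (z : Fin n → ℂ)
    (j : Fin n) : inner ℝ (z j) ((B *ᵥ z) j) ≤ ‖z j‖ * (metzlerOf B *ᵥ fun i => ‖z i‖) j := by
  simp only [Matrix.mulVec, dotProduct, inner_sum, Finset.mul_sum]
  refine Finset.sum_le_sum fun i _ => ?_
  rcases eq_or_ne j i with rfl | hji
  · refine le_of_eq ?_
    rw [Complex.inner, mul_assoc, Complex.mul_conj', ← Complex.ofReal_pow, Complex.re_mul_ofReal,
      metzlerOf, Matrix.of_apply, if_pos rfl]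
    ring
  · rw [metzlerOf, Matrix.of_apply, if_neg hji, ← norm_mul]
    exact real_inner_le_norm _ _

theorem metzlerOf_le_Lam (A : Fin N → Matrix (Fin n) (Fin n) ℝ) (V : Matrix (Fin n) (Fin n) ℂ)
    (i : Fin N) (j l : Fin n) : metzlerOf (V⁻¹ * toC (A i) * V) j l ≤ Lam A V j l :=
  le_ciSup (f := fun i => metzlerOf (V⁻¹ * toC (A i) * V) j l) (Set.finite_range _).bddAbove i

theorem isMetzler_Lam (A : Fin N → Matrix (Fin n) (Fin n) ℝ) (V : Matrix (Fin n) (Fin n) ℂ) :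
    IsMetzler (Lam A V) := fun j l hjl =>
  Real.iSup_nonneg fun i => by
    rw [metzlerOf, Matrix.of_apply, if_neg hjl]
    exact norm_nonneg _

theorem inner_modalMap_mulVec_le {A : Fin N → Matrix (Fin n) (Fin n) ℝ}
    {V : Matrix (Fin n) (Fin n) ℂ} (hV : IsUnit V) (i : Fin N) (x : Fin n → ℝ) (j : Fin n) :
    inner ℝ (modalMap V⁻¹ x j) (modalMap V⁻¹ (A i *ᵥ x) j) ≤
      absMulVec V⁻¹ x j * (Lam A V *ᵥ absMulVec V⁻¹ x) j := by
  have hmul : modalMap V⁻¹ (A i *ᵥ x) = (V⁻¹ * toC (A i) * V) *ᵥ modalMap V⁻¹ x := by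
    rw [modalMap_mulVec, ← Matrix.mulVec_mulVec, mulVec_modalMap_inv hV, modalMap_apply]
  rw [hmul]
  refine (inner_mulVec_le_norm_mul_metzlerOf _ _ j).trans ?_
  refine mul_le_mul_of_nonneg_left ?_ (norm_nonneg _)
  exact dotProduct_le_dotProduct_of_nonneg_right (metzlerOf_le_Lam A V i j)
    (absMulVec_nonneg V⁻¹ x)

theorem absMulVec_le_psi (H : ∀ i, Matrix (Fin n) (Fin (k i)) ℝ)
    (δ : ∀ i, (Fin n → ℝ) → (Fin (k i) → ℝ)) (V : Matrix (Fin n) (Fin n) ℂ) {c : Fin n → ℝ}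
    {i : Fin N} {ω : Fin (k i) → ℝ} (hω : |ω| ≤ δ i (absMat V *ᵥ c)) :
    absMulVec (V⁻¹ * toC (H i)) ω ≤ psi H δ V c := fun j => by
  have hbox : {w : Fin (k i) → ℝ | ∀ l, |w l| ≤ δ i (absMat V *ᵥ c) l}
      = Set.Icc (-δ i (absMat V *ᵥ c)) (δ i (absMat V *ᵥ c)) :=
    Set.ext fun w => by simp only [Set.mem_ofPred_eq, abs_le, Set.mem_Icc, Pi.le_def,
      Pi.neg_apply, forall_and]
  refine le_ciSup_of_le (Set.finite_range _).bddAbove i (le_csSup ?_ ⟨ω, hω, rfl⟩)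
  rw [hbox]
  exact (isCompact_Icc.image ((continuous_apply j).comp (continuous_absMulVec _))).bddAbove

theorem inner_modalMap_le_Lam_add_psi {A : Fin N → Matrix (Fin n) (Fin n) ℝ}
    {H : ∀ i, Matrix (Fin n) (Fin (k i)) ℝ} {δ : ∀ i, (Fin n → ℝ) → (Fin (k i) → ℝ)}
    {V : Matrix (Fin n) (Fin n) ℂ} (hV : IsUnit V) (x : Fin n → ℝ) {c : Fin n → ℝ} {i : Fin N}
    {ω : Fin (k i) → ℝ} (hω : |ω| ≤ δ i (absMat V *ᵥ c)) (j : Fin n) :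
    inner ℝ (modalMap V⁻¹ x j) (modalMap V⁻¹ (A i *ᵥ x + H i *ᵥ ω) j) ≤
      absMulVec V⁻¹ x j * ((Lam A V *ᵥ absMulVec V⁻¹ x) j + psi H δ V c j) := by
  rw [map_add, Pi.add_apply, inner_add_right, mul_add]
  refine add_le_add (inner_modalMap_mulVec_le hV i x j) ((real_inner_le_norm _ _).trans ?_)
  rw [modalMap_mulVec]
  exact mul_le_mul_of_nonneg_left (absMulVec_le_psi H δ V hω j) (norm_nonneg _)

end Modal

/-! ### Trajectories -/

section Trajectories

variable {n N : ℕ} {k : Fin N → ℕ} {A : Fin N → Matrix (Fin n) (Fin n) ℝ}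
  {H : ∀ i, Matrix (Fin n) (Fin (k i)) ℝ} {δ : ∀ i, (Fin n → ℝ) → (Fin (k i) → ℝ)} {τ : ℝ}
  {V : Matrix (Fin n) (Fin n) ℂ} {σ : ℝ → Fin N} {w : ∀ i, ℝ → (Fin (k i) → ℝ)}
  {x : ℝ → Fin n → ℝ}

theorem IsTrajectory.isIndefiniteIntegral (h : IsTrajectory A H δ τ σ w x) :
    IsIndefiniteIntegral (rhs A H σ w x) x 0 :=
  ⟨h.integrable, h.solves⟩

theorem theta_nonneg (τ : ℝ) (x : ℝ → Fin n → ℝ) (t : ℝ) : 0 ≤ theta τ x t := fun _ =>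
  Real.sSup_nonneg (Set.forall_mem_image.2 fun _ _ => abs_nonneg _)

theorem theta_zero (x : ℝ → Fin n → ℝ) (t : ℝ) : theta 0 x t = |x t| := by
  funext j
  rw [theta, sub_zero, Set.Icc_self, Set.image_singleton, csSup_singleton, Pi.abs_apply]

theorem theta_le (hτ : 0 ≤ τ) {t : ℝ} {c : Fin n → ℝ}
    (hc : ∀ s ∈ Set.Icc (t - τ) t, |x s| ≤ c) : theta τ x t ≤ c := fun j =>
  csSup_le ((Set.nonempty_Icc.2 (sub_le_self t hτ)).image _)
    (Set.forall_mem_image.2 fun s hs => hc s hs j)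

theorem theta_le_absMat_mulVec (hτ : 0 ≤ τ) (hV : IsUnit V) {t : ℝ} {c : Fin n → ℝ}
    (hc : ∀ s ∈ Set.Icc (t - τ) t, absMulVec V⁻¹ (x s) ≤ c) : theta τ x t ≤ absMat V *ᵥ c :=
  theta_le hτ fun s hs =>
    (abs_le_absMat_mulVec_absMulVec hV (x s)).trans (mulVec_mono (absMat_nonneg V) (hc s hs))

theorem IsTrajectory.continuousOn_absMulVec (h : IsTrajectory A H δ τ σ w x)
    (M : Matrix (Fin n) (Fin n) ℂ) :
    ContinuousOn (fun t => absMulVec M (x t)) (Set.Ici (-τ)) :=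
  (continuous_absMulVec M).comp_continuousOn h.cont

theorem IsTrajectory.inner_modalMap_rhs_le (h : IsTrajectory A H δ τ σ w x) (hτ : 0 ≤ τ)
    (hδ : ∀ i, IsCNI (δ i)) (hV : IsUnit V) {t : ℝ} (ht : 0 ≤ t) {c : Fin n → ℝ}
    (hc : ∀ s ∈ Set.Icc (t - τ) t, absMulVec V⁻¹ (x s) ≤ c) (j : Fin n) :
    inner ℝ (modalMap V⁻¹ (x t) j) (modalMap V⁻¹ (rhs A H σ w x t) j) ≤
      absMulVec V⁻¹ (x t) j * ((Lam A V *ᵥ absMulVec V⁻¹ (x t)) j + psi H δ V c j) :=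
  inner_modalMap_le_Lam_add_psi hV (x t)
    (LE.le.trans (h.bound (σ t) t ht)
      ((hδ _).mono _ _ (theta_nonneg τ x t) (theta_le_absMat_mulVec hτ hV hc))) j

theorem eventually_forall_mem_Icc_sub {p : ℝ → Prop} {t : ℝ}
    (hp : ∀ s ∈ Set.Icc (t - τ) t, p s) (hp' : ∀ᶠ s in 𝓝[≥] t, p s) :
    ∀ᶠ v in 𝓝[≥] t, ∀ s ∈ Set.Icc (v - τ) v, p s := by
  obtain ⟨u, htu, hu⟩ := mem_nhdsGE_iff_exists_Ico_subset.1 hp'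
  filter_upwards [Ico_mem_nhdsGE htu] with v hv s hs
  rcases le_total s t with hst | hts
  · exact hp s ⟨(sub_le_sub_right hv.1 τ).trans hs.1, hst⟩
  · exact hu ⟨hts, hs.2.trans_lt hv.2⟩

theorem IsTrajectory.isDelaySubsolution (h : IsTrajectory A H δ τ σ w x) (hτ : 0 ≤ τ)
    (hδ : ∀ i, IsCNI (δ i)) (hV : IsUnit V) :
    IsDelaySubsolution (Lam A V) (psi H δ V) τ 0 (fun t => absMulVec V⁻¹ (x t)) where
  nonneg t := absMulVec_nonneg V⁻¹ (x t)
  continuousOn := by simpa only [zero_sub] using h.continuousOn_absMulVec V⁻¹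
  eventually_le t ht j hj c hc m hm := by
    have hcont : ContinuousWithinAt (fun v => absMulVec V⁻¹ (x v)) (Set.Ici t) t :=
      (h.continuousOn_absMulVec V⁻¹ t ((neg_nonpos.2 hτ).trans ht)).mono
        (Set.Ici_subset_Ici.2 ((neg_nonpos.2 hτ).trans ht))
    have hcont_apply := fun i => (continuous_apply i).continuousAt.comp_continuousWithinAt hcont
    have hwindow : ∀ᶠ v in 𝓝[≥] t, ∀ s ∈ Set.Icc (v - τ) v, ∀ i, absMulVec V⁻¹ (x s) i < c i :=
      eventually_forall_mem_Icc_sub hc <| eventually_all.2 fun i =>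
        (hcont_apply i).eventually (gt_mem_nhds (hc t ⟨sub_le_self t hτ, le_rfl⟩ i))
    have hrate : ∀ᶠ v in 𝓝[≥] t, absMulVec V⁻¹ (x v) j *
        ((Lam A V *ᵥ absMulVec V⁻¹ (x v)) j + psi H δ V c j) ≤ m * absMulVec V⁻¹ (x t) j := by
      have hΛcont : Continuous fun y : Fin n → ℝ =>
          y j * ((Lam A V *ᵥ y) j + psi H δ V c j) := by fun_prop
      refine ((hΛcont.continuousAt.comp_continuousWithinAt hcont).eventually
        (gt_mem_nhds ?_)).mono fun v hv => hv.le
      rw [mul_comm m]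
      exact mul_lt_mul_of_pos_left hm hj
    refine (h.isIndefiniteIntegral.clm_comp
      (ContinuousLinearMap.proj j ∘L modalMap V⁻¹)).eventually_norm_le_add_mul ht hj ?_
    filter_upwards [hwindow, hrate, self_mem_nhdsWithin] with v hv hle htv
    exact (h.inner_modalMap_rhs_le hτ hδ hV (ht.trans htv) (fun s hs i => (hv s hs i).le)
      j).trans hle

theorem limsupLe_of_eventually_le_add {v : ℝ → Fin n → ℝ} {b : Fin n → ℝ}
    (h : ∀ j, ∀ ε : ℝ, 0 < ε → ∀ᶠ t in atTop, v t j ≤ b j + ε) : LimsupLe v b := by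
  refine fun j => EReal.le_of_forall_lt_iff_le.1 fun a ha => ?_
  refine limsup_le_of_le (by isBoundedDefault) ?_
  filter_upwards [h j (a - b j) (sub_pos.2 (EReal.coe_lt_coe_iff.1 ha))] with t ht
  rwa [EReal.coe_le_coe_iff, ← add_sub_cancel (b j) a]

end Trajectories

/-! ### Iterated bounds -/

section Iterates

variable {n : ℕ} {f : (Fin n → ℝ) → (Fin n → ℝ)} {a : Fin n → ℝ}

theorem IsCNI.iterate (hf : IsCNI f) (m : ℕ) : IsCNI f^[m] := by
  induction m with
  | zero => exact ⟨fun _ hx => hx, fun _ _ _ hxy => hxy⟩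
  | succ m ih =>
    rw [Function.iterate_succ]
    exact ⟨fun x hx => ih.nonneg _ (hf.nonneg x hx),
      fun x y hx hxy => ih.mono _ _ (hf.nonneg x hx) (hf.mono x y hx hxy)⟩

theorem IsCNI.antitone_iterate (hf : IsCNI f) (ha : 0 ≤ a) (hfa : f a ≤ a) :
    Antitone fun m => f^[m] a :=
  antitone_nat_of_succ_le fun m => (hf.iterate m).mono _ _ (hf.nonneg a ha) hfa

theorem IsCNI.exists_tendsto_iterate (hf : IsCNI f) (ha : 0 ≤ a) (hfa : f a ≤ a) :
    ∃ b, Tendsto (fun m => f^[m] a) atTop (𝓝 b) ∧ b ≤ a :=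
  have hbdd : BddBelow (Set.range fun m => f^[m] a) :=
    ⟨0, Set.forall_mem_range.2 fun m => (hf.iterate m).nonneg a ha⟩
  ⟨_, tendsto_atTop_ciInf (hf.antitone_iterate ha hfa) hbdd, ciInf_le hbdd 0⟩

variable {Λ F : Matrix (Fin n) (Fin n) ℝ} {δ : (Fin n → ℝ) → (Fin n → ℝ)} {τ T : ℝ}
  {u : ℝ → Fin n → ℝ}

theorem IsCNI.tzero (hδ : IsCNI δ) (hΛ : ∀ i j, 0 ≤ (-Λ⁻¹) i j) : IsCNI (Tzero Λ δ) :=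
  ⟨fun x hx => mulVec_nonneg hΛ (hδ.nonneg x hx),
    fun x y hx hxy => mulVec_mono hΛ (hδ.mono x y hx hxy)⟩

theorem Tzero_bTilde_le (hΛ : IsUnit Λ) (hΛ' : ∀ i j, 0 ≤ (-Λ⁻¹) i j)
    (hR : IsUnit (1 - Rmat Λ F)) {w : Fin n → ℝ}
    (hδ : δ (bTilde Λ F w) ≤ F *ᵥ bTilde Λ F w + w) :
    Tzero Λ δ (bTilde Λ F w) ≤ bTilde Λ F w := by
  have hfix : F *ᵥ bTilde Λ F w + w = -(Λ *ᵥ bTilde Λ F w) := by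
    rw [eq_neg_iff_add_eq_zero, add_right_comm, ← Matrix.add_mulVec, add_comm F,
      add_mulVec_bTilde hΛ hR, neg_add_cancel]
  refine (mulVec_mono hΛ' hδ).trans_eq ?_
  dsimp only
  rw [hfix, Matrix.neg_mulVec, Matrix.mulVec_neg, neg_neg, Matrix.mulVec_mulVec,
    Matrix.nonsing_inv_mul _ ((Matrix.isUnit_iff_isUnit_det Λ).1 hΛ), Matrix.one_mulVec]

theorem IsDelaySubsolution.eventually_le_iterate_tzero_add (h : IsDelaySubsolution Λ δ τ T u)
    (hτ : 0 ≤ τ) (hΛ : IsMetzler Λ) {η : Fin n → ℝ} (hη : IsStabilityCertificate Λ η)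
    (hδ : IsCNI δ) (hcont : ContinuousOn δ (Set.Ici 0)) (ha : 0 ≤ a)
    (hua : ∀ j, ∀ ε > 0, ∀ᶠ t in atTop, u t j ≤ a j + ε) (m : ℕ) :
    ∀ j, ∀ ε > 0, ∀ᶠ t in atTop, u t j ≤ (Tzero Λ δ)^[m] a j + ε := by
  induction m with
  | zero => exact hua
  | succ m ih =>
    intro j ε hε
    rw [Function.iterate_succ_apply']
    exact h.eventually_le_neg_inv_mulVec_add_of_continuousOn hτ hΛ hη hδ.nonneg hcont
      (((hδ.tzero (hΛ.neg_inv_nonneg hη)).iterate m).nonneg a ha) ih j hε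

theorem eventually_le_add_of_tendsto {a : ℕ → Fin n → ℝ} {b : Fin n → ℝ}
    (hab : Tendsto a atTop (𝓝 b))
    (hua : ∀ m, ∀ j, ∀ ε > 0, ∀ᶠ t in atTop, u t j ≤ a m j + ε) (j : Fin n) {ε : ℝ}
    (hε : 0 < ε) : ∀ᶠ t in atTop, u t j ≤ b j + ε := by
  obtain ⟨m, hm⟩ := ((tendsto_pi_nhds.1 hab j).eventually
    (gt_mem_nhds (lt_add_of_pos_right (b j) (half_pos hε)))).exists
  filter_upwards [hua m j (ε / 2) (half_pos hε)] with t ht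
  linarith

end Iterates

/-! ### Quadratic Lyapunov functions -/

section QuadraticForm

variable {ι : Type*} [Fintype ι]

theorem exists_pos_forall_mul_norm_sq_le {Q : Matrix ι ι ℝ} (hQ : Q.PosDef) :
    ∃ q > 0, ∀ u : ι → ℝ, q * ‖u‖ ^ 2 ≤ u ⬝ᵥ Q *ᵥ u := by
  have hpos : ∀ v ∈ Metric.sphere (0 : ι → ℝ) 1, 0 < v ⬝ᵥ Q *ᵥ v := fun v hv => by
    simpa only [star_trivial] using
      hQ.dotProduct_mulVec_pos (Metric.ne_of_mem_sphere hv one_ne_zero)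
  have hcont : Continuous fun v : ι → ℝ => v ⬝ᵥ Q *ᵥ v :=
    continuous_id.dotProduct (continuous_const.matrix_mulVec continuous_id)
  obtain ⟨q, hq, hle⟩ := (isCompact_sphere (0 : ι → ℝ) 1).exists_forall_le' hcont.continuousOn hpos
  refine ⟨q, hq, fun u => ?_⟩
  rcases eq_or_ne u 0 with rfl | hu
  · simp
  · have hnorm : ‖u‖ ≠ 0 := norm_ne_zero_iff.2 hu
    have hunit := hle (‖u‖⁻¹ • u) (by simp [norm_smul, hnorm])
    rw [Matrix.mulVec_smul, smul_dotProduct, dotProduct_smul, smul_eq_mul, smul_eq_mul,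
      ← mul_assoc, ← mul_inv, ← sq] at hunit
    rwa [← le_inv_mul_iff₀' (by positivity)]

theorem dotProduct_le_norm_mul_sum_abs (u v : ι → ℝ) : u ⬝ᵥ v ≤ ‖u‖ * ∑ i, |v i| := by
  rw [Finset.mul_sum]
  refine Finset.sum_le_sum fun i _ => (le_abs_self _).trans ?_
  rw [abs_mul]
  exact mul_le_mul_of_nonneg_right (norm_le_pi_norm u i) (abs_nonneg _)

theorem tendsto_dotProduct_mulVec_sub_dotProduct_atTop {Q : Matrix ι ι ℝ} (hQ : Q.PosDef)
    (v : ι → ℝ) :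
    Tendsto (fun u => u ⬝ᵥ Q *ᵥ u - u ⬝ᵥ v) (Bornology.cobounded (ι → ℝ)) atTop := by
  obtain ⟨q, hq, hqQ⟩ := exists_pos_forall_mul_norm_sq_le hQ
  have hlim : Tendsto (fun r : ℝ => r * (q * r - ∑ i, |v i|)) atTop atTop :=
    tendsto_id.atTop_mul_atTop₀
      (tendsto_atTop_add_const_right _ _ (tendsto_id.const_mul_atTop hq))
  refine tendsto_atTop_mono (fun u => ?_) (hlim.comp tendsto_norm_cobounded_atTop)
  calc ‖u‖ * (q * ‖u‖ - ∑ i, |v i|) = q * ‖u‖ ^ 2 - ‖u‖ * ∑ i, |v i| := by ring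
    _ ≤ u ⬝ᵥ Q *ᵥ u - u ⬝ᵥ v := sub_le_sub (hqQ u) (dotProduct_le_norm_mul_sum_abs u v)

theorem dotProduct_mulVec_comm {P : Matrix ι ι ℝ} (hP : P.IsSymm) (x y : ι → ℝ) :
    x ⬝ᵥ P *ᵥ y = y ⬝ᵥ P *ᵥ x := by
  rw [Matrix.dotProduct_mulVec, ← Matrix.mulVec_transpose, hP.eq, dotProduct_comm]

theorem dotProduct_transpose_mul_add_mul_mulVec {P : Matrix ι ι ℝ} (hP : P.IsSymm)
    (B : Matrix ι ι ℝ) (x : ι → ℝ) :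
    x ⬝ᵥ (Bᵀ * P + P * B) *ᵥ x = 2 * (x ⬝ᵥ P *ᵥ B *ᵥ x) := by
  have hadj : x ⬝ᵥ Bᵀ *ᵥ P *ᵥ x = x ⬝ᵥ P *ᵥ B *ᵥ x := by
    rw [Matrix.dotProduct_mulVec, Matrix.vecMul_transpose, dotProduct_mulVec_comm hP]
  rw [Matrix.add_mulVec, dotProduct_add, ← Matrix.mulVec_mulVec, ← Matrix.mulVec_mulVec, hadj,
    two_mul]

theorem contDiff_quadForm {n : ℕ} (P : Matrix (Fin n) (Fin n) ℝ) : ContDiff ℝ 1 (quadForm P) := by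
  unfold quadForm dotProduct Matrix.mulVec dotProduct
  fun_prop

theorem fderiv_quadForm {n : ℕ} {P : Matrix (Fin n) (Fin n) ℝ} (hP : P.IsSymm)
    (x y : Fin n → ℝ) : fderiv ℝ (quadForm P) x y = 2 * (x ⬝ᵥ P *ᵥ y) := by
  have hbilin := (Matrix.toLinearMap₂' ℝ P).toContinuousBilinearMap.hasFDerivAt_of_bilinear
    (hasFDerivAt_id x) (hasFDerivAt_id x)
  have hderiv : HasFDerivAt (quadForm P) _ x :=
    hbilin.congr_of_eventuallyEq (.of_forall fun z => (Matrix.toLinearMap₂'_apply' P z z).symm)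
  rw [hderiv.fderiv, two_mul]
  refine (congrArg₂ (· + ·) (Matrix.toLinearMap₂'_apply' P x y)
    (Matrix.toLinearMap₂'_apply' P y x)).trans ?_
  rw [dotProduct_mulVec_comm hP y x]

end QuadraticForm

section LyapunovFunction

variable {n N : ℕ} {k : Fin N → ℕ} {A : Fin N → Matrix (Fin n) (Fin n) ℝ}
  {H : ∀ i, Matrix (Fin n) (Fin (k i)) ℝ} {δ : ∀ i, (Fin n → ℝ) → (Fin (k i) → ℝ)}
  {V : Matrix (Fin n) (Fin n) ℂ} {D F : Matrix (Fin n) (Fin n) ℝ} {wbar : Fin n → ℝ}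

theorem isSymm_Pmat (V : Matrix (Fin n) (Fin n) ℂ) (hD : D.IsSymm) : (Pmat V D).IsSymm := by
  have hDH : (toC D).IsHermitian := Matrix.IsHermitian.ext fun i j => by
    change star (D j i : ℂ) = D i j
    rw [RCLike.star_def, Complex.conj_ofReal, hD.apply]
  refine Matrix.IsSymm.ext fun i j => ?_
  rw [Pmat, Matrix.map_apply, Matrix.map_apply,
    ← (Matrix.isHermitian_conjTranspose_mul_mul V⁻¹ hDH).apply i j]
  exact (Complex.conj_re _).symm

theorem mulVec_apply_of_isDiag (hD : D.IsDiag) (v : Fin n → ℝ) (j : Fin n) :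
    (D *ᵥ v) j = D j j * v j := by
  conv_lhs => rw [← hD.diagonal_diag]
  rw [Matrix.mulVec_diagonal, Matrix.diag_apply]

theorem dotProduct_Pmat_mulVec (V : Matrix (Fin n) (Fin n) ℂ) (hD : D.IsDiag) (x y : Fin n → ℝ) :
    x ⬝ᵥ Pmat V D *ᵥ y
      = ∑ j, D j j * inner ℝ (modalMap V⁻¹ x j) (modalMap V⁻¹ y j) := by
  have hre : x ⬝ᵥ Pmat V D *ᵥ y
      = (star (fun i => (x i : ℂ)) ⬝ᵥ ((V⁻¹)ᴴ * toC D * V⁻¹) *ᵥ fun i => (y i : ℂ)).re := by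
    simp only [dotProduct, Matrix.mulVec, Complex.re_sum, Pi.star_apply, Pmat, Matrix.map_apply,
      RCLike.star_def, Complex.conj_ofReal, Complex.re_ofReal_mul, Complex.re_mul_ofReal]
  have hdiag : toC D = Matrix.diagonal fun j => (D j j : ℂ) := by
    conv_lhs => rw [← hD.diagonal_diag]
    exact Matrix.diagonal_map Complex.ofReal_zero
  rw [hre, ← Matrix.mulVec_mulVec, ← Matrix.mulVec_mulVec, Matrix.dotProduct_mulVec,
    ← Matrix.star_mulVec, hdiag, dotProduct, Complex.re_sum]
  refine Finset.sum_congr rfl fun j _ => ?_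
  rw [Matrix.mulVec_diagonal, Pi.star_apply, mul_left_comm, Complex.re_ofReal_mul,
    mul_comm (star _), Complex.inner]
  rfl

theorem dotProduct_Pmat_mulVec_le (hV : IsUnit V) (hD : D.IsDiag) (hD' : ∀ j, 0 ≤ D j j)
    (hψ : ∀ c : Fin n → ℝ, 0 ≤ c → psi H δ V c ≤ F *ᵥ c + wbar) (x : Fin n → ℝ) {i : Fin N}
    {ω : Fin (k i) → ℝ} (hω : |ω| ≤ δ i (absMat V *ᵥ absMulVec V⁻¹ x)) :
    x ⬝ᵥ Pmat V D *ᵥ (A i *ᵥ x + H i *ᵥ ω) ≤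
      absMulVec V⁻¹ x ⬝ᵥ D *ᵥ ((Lam A V + F) *ᵥ absMulVec V⁻¹ x + wbar) := by
  rw [dotProduct_Pmat_mulVec V hD]
  refine Finset.sum_le_sum fun j _ => ?_
  rw [mulVec_apply_of_isDiag hD, mul_left_comm, Matrix.add_mulVec, add_assoc]
  refine mul_le_mul_of_nonneg_left ((inner_modalMap_le_Lam_add_psi hV x hω j).trans ?_) (hD' j)
  exact mul_le_mul_of_nonneg_left (add_le_add_right (hψ _ (absMulVec_nonneg V⁻¹ x) j) _)
    (absMulVec_nonneg V⁻¹ x j)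

theorem tendsto_absMulVec_inv_cobounded (hV : IsUnit V) :
    Tendsto (absMulVec V⁻¹) (Bornology.cobounded _) (Bornology.cobounded _) := by
  have hinj : LinearMap.ker (modalMap V⁻¹ : (Fin n → ℝ) →ₗ[ℝ] Fin n → ℂ) = ⊥ := by
    refine LinearMap.ker_eq_bot'.2 fun x hx => funext fun i => ?_
    have hVx := congrFun (mulVec_modalMap_inv hV x) i
    rw [← ContinuousLinearMap.coe_coe, hx, Matrix.mulVec_zero] at hVx
    exact Complex.ofReal_eq_zero.1 hVx.symm
  obtain ⟨K, -, hK⟩ := LinearMap.exists_antilipschitzWith _ hinj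
  rw [← tendsto_norm_atTop_iff_cobounded]
  refine (tendsto_norm_cobounded_atTop.comp hK.tendsto_cobounded).congr fun x => ?_
  simp [Pi.norm_def, absMulVec_apply]

theorem eventually_dotProduct_Pmat_mulVec_le (hδ : ∀ i, IsCNI (δ i)) (hV : IsUnit V)
    (hψ : ∀ c : Fin n → ℝ, 0 ≤ c → psi H δ V c ≤ F *ᵥ c + wbar)
    (hD : IsDiagLyap (Lam A V + F) D) (m : ℝ) :
    ∀ᶠ x in Bornology.cobounded (Fin n → ℝ), ∀ i, ∀ ω : Fin (k i) → ℝ, |ω| ≤ δ i |x| →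
      2 * (x ⬝ᵥ Pmat V D *ᵥ (A i *ᵥ x + H i *ᵥ ω)) ≤ m := by
  have hlim := (tendsto_dotProduct_mulVec_sub_dotProduct_atTop hD.2.2 ((2 : ℝ) • D *ᵥ wbar)).comp
    (tendsto_absMulVec_inv_cobounded hV)
  filter_upwards [hlim.eventually_ge_atTop (-m)] with x hx i ω hω
  have hω' : |ω| ≤ δ i (absMat V *ᵥ absMulVec V⁻¹ x) :=
    hω.trans ((hδ i).mono _ _ (abs_nonneg x) (abs_le_absMat_mulVec_absMulVec hV x))
  set u := absMulVec V⁻¹ x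
  calc 2 * (x ⬝ᵥ Pmat V D *ᵥ (A i *ᵥ x + H i *ᵥ ω))
      ≤ 2 * (u ⬝ᵥ D *ᵥ ((Lam A V + F) *ᵥ u + wbar)) :=
        mul_le_mul_of_nonneg_left (dotProduct_Pmat_mulVec_le hV hD.1 (fun j => hD.2.1.diag_pos.le)
          hψ x hω') zero_le_two
    _ = -(u ⬝ᵥ (-((Lam A V + F)ᵀ * D + D * (Lam A V + F))) *ᵥ u - u ⬝ᵥ (2 : ℝ) • D *ᵥ wbar) := by
        rw [Matrix.neg_mulVec, dotProduct_neg,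
          dotProduct_transpose_mul_add_mul_mulVec hD.1.isSymm, Matrix.mulVec_add, dotProduct_add,
          dotProduct_smul, smul_eq_mul]
        ring
    _ ≤ m := neg_le.1 hx

theorem upperDini_le_of_eventually_le {q : ℝ → ℝ} {t m : ℝ}
    (hq : ∀ᶠ s in 𝓝[>] t, q s ≤ q t + m * (s - t)) : upperDini q t ≤ m := by
  have hshift : Tendsto (fun h => t + h) (𝓝[>] 0) (𝓝[>] t) :=
    tendsto_nhdsWithin_iff.2 ⟨((continuous_const_add t).tendsto' 0 t (add_zero t)).mono_left
      nhdsWithin_le_nhds, by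
        filter_upwards [self_mem_nhdsWithin] with h using lt_add_of_pos_right t⟩
  refine limsup_le_of_le (by isBoundedDefault) ?_
  filter_upwards [hshift.eventually hq, self_mem_nhdsWithin] with h hle hpos
  rw [EReal.coe_le_coe_iff, div_le_iff₀ hpos]
  linarith

theorem IsTrajectory.upperDini_quadForm_le {σ : ℝ → Fin N} {w : ∀ i, ℝ → (Fin (k i) → ℝ)}
    {x : ℝ → Fin n → ℝ} (h : IsTrajectory A H δ 0 σ w x) {P : Matrix (Fin n) (Fin n) ℝ}
    (hP : P.IsSymm) {U : Set (Fin n → ℝ)} (hU : IsOpen U) {m : ℝ}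
    (hm : ∀ y ∈ U, ∀ i, ∀ ω : Fin (k i) → ℝ, |ω| ≤ δ i |y| →
      2 * (y ⬝ᵥ P *ᵥ (A i *ᵥ y + H i *ᵥ ω)) ≤ m)
    {t : ℝ} (ht : 0 ≤ t) (hxt : x t ∈ U) : upperDini (fun s => quadForm P (x s)) t ≤ m := by
  have hcont : ContinuousWithinAt x (Set.Ici t) t :=
    (h.cont t (neg_zero.trans_le ht)).mono (Set.Ici_subset_Ici.2 (neg_zero.trans_le ht))
  refine upperDini_le_of_eventually_le
    ((h.isIndefiniteIntegral.comp_contDiff (contDiff_quadForm P)).eventually_le_add_mul ht ?_)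
  filter_upwards [hcont.eventually (hU.mem_nhds hxt), self_mem_nhdsWithin] with v hv htv
  rw [fderiv_quadForm hP]
  refine hm (x v) hv (σ v) (w (σ v) v) ?_
  rw [← theta_zero x v]
  exact h.bound (σ v) v (ht.trans htv)

end LyapunovFunction

section Bounds

variable {n N : ℕ} {k : Fin N → ℕ} {A : Fin N → Matrix (Fin n) (Fin n) ℝ}
  {H : ∀ i, Matrix (Fin n) (Fin (k i)) ℝ} {δ : ∀ i, (Fin n → ℝ) → (Fin (k i) → ℝ)}
  {V : Matrix (Fin n) (Fin n) ℂ} {F D : Matrix (Fin n) (Fin n) ℝ} {wbar : Fin n → ℝ}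

theorem exists_forall_lt_norm_toLp {p : (Fin n → ℝ) → Prop}
    (hp : ∀ᶠ x in Bornology.cobounded (Fin n → ℝ), p x) :
    ∃ r : ℝ, ∀ x : Fin n → ℝ, r < ‖WithLp.toLp 2 x‖ → p x := by
  have hp' := (PiLp.antilipschitzWith_ofLp 2 fun _ : Fin n => ℝ).tendsto_cobounded.eventually hp
  obtain ⟨r, -, hr⟩ := (atTop_basis_Ioi.cobounded_of_norm).eventually_iff.1 hp'
  exact ⟨r, fun x hx => hr (x := WithLp.toLp 2 x) hx⟩

theorem IsDiagLyap.exists_forall_derivative_neg (hD : IsDiagLyap (Lam A V + F) D)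
    (hδ : ∀ i, IsCNI (δ i)) (hV : IsUnit V)
    (hψ : ∀ c : Fin n → ℝ, 0 ≤ c → psi H δ V c ≤ F *ᵥ c + wbar) :
    ∃ r : ℝ,
      (∀ i, ∀ ξ : Fin n → ℝ, ∀ ω : Fin (k i) → ℝ,
        (∀ l, |ω l| ≤ δ i (fun j => |ξ j|) l) → r < ‖WithLp.toLp 2 ξ‖ →
        ξ ⬝ᵥ (((A i)ᵀ * Pmat V D + Pmat V D * A i) *ᵥ ξ)
          + 2 * (ξ ⬝ᵥ (Pmat V D *ᵥ (H i *ᵥ ω))) < 0) ∧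
      (∀ σ w x, IsTrajectory A H δ 0 σ w x → ∀ t, 0 ≤ t → r < ‖WithLp.toLp 2 (x t)‖ →
        upperDini (fun s => quadForm (Pmat V D) (x s)) t < 0) := by
  have hP : (Pmat V D).IsSymm := isSymm_Pmat V hD.1.isSymm
  obtain ⟨r, hr⟩ := exists_forall_lt_norm_toLp
    (eventually_dotProduct_Pmat_mulVec_le hδ hV hψ hD (-1))
  refine ⟨r, fun i ξ ω hω hξ => ?_, fun σ w x h t ht hxt => ?_⟩
  · have hle := hr ξ hξ i ω hω
    rw [Matrix.mulVec_add, dotProduct_add, mul_add,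
      ← dotProduct_transpose_mul_add_mul_mulVec hP] at hle
    exact hle.trans_lt neg_one_lt_zero
  · have hopen : IsOpen {y : Fin n → ℝ | r < ‖WithLp.toLp 2 y‖} :=
      isOpen_lt continuous_const (PiLp.continuous_toLp 2 _).norm
    refine (h.upperDini_quadForm_le hP hopen hr ht hxt).trans_lt ?_
    exact_mod_cast neg_one_lt_zero (R := ℝ)

end Bounds

end SwitchSys

theorem mainTheorem2_general {n N : ℕ} {k : Fin N → ℕ}
    (A : Fin N → Matrix (Fin n) (Fin n) ℝ) (H : ∀ i, Matrix (Fin n) (Fin (k i)) ℝ)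
    (δ : ∀ i, (Fin n → ℝ) → (Fin (k i) → ℝ))
    (hδ_cni : ∀ i, IsCNI (δ i))
    (τ : ℝ) (hτ : 0 ≤ τ)
    (V : Matrix (Fin n) (Fin n) ℂ) (hV : IsUnit V)
    (hΛ : IsHurwitz (Lam A V))
    (F : Matrix (Fin n) (Fin n) ℝ) (wbar : Fin n → ℝ)
    (hF : ∀ i j, 0 ≤ F i j) (hw : 0 ≤ wbar)
    (hψ : ∀ x : Fin n → ℝ, 0 ≤ x → psi H δ V x ≤ F *ᵥ x + wbar)
    (hR : specRad (Rmat (Lam A V) F) < 1) :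
    (IsUnit (1 - Rmat (Lam A V) F) ∧ 0 ≤ bTilde (Lam A V) F wbar) ∧
    (∀ σ w x, IsTrajectory A H δ τ σ w x →
      (∀ t, -τ ≤ t → t ≤ 0 → absMulVec V⁻¹ (x t) ≤ bTilde (Lam A V) F wbar) →
      ∀ t, -τ ≤ t → absMulVec V⁻¹ (x t) ≤ bTilde (Lam A V) F wbar) ∧
    (∀ σ w x, IsTrajectory A H δ τ σ w x →
      LimsupLe (fun t => absMulVec V⁻¹ (x t)) (bTilde (Lam A V) F wbar)) ∧
    (∀ δ' : (Fin n → ℝ) → (Fin n → ℝ), ContinuousOn δ' (Set.Ici 0) → IsCNI δ' →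
      (∀ x : Fin n → ℝ, 0 ≤ x → psi H δ V x ≤ δ' x ∧ δ' x ≤ F *ᵥ x + wbar) →
      ∃ b : Fin n → ℝ,
        Tendsto (fun m : ℕ => (Tzero (Lam A V) δ')^[m] (bTilde (Lam A V) F wbar)) atTop (𝓝 b) ∧
        b ≤ bTilde (Lam A V) F wbar ∧
        ∀ σ w x, IsTrajectory A H δ τ σ w x →
          LimsupLe (fun t => absMulVec V⁻¹ (x t)) b) ∧
    (∃ D, IsDiagLyap (Lam A V + F) D) ∧
    (τ = 0 → ∀ D, IsDiagLyap (Lam A V + F) D →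
      ∃ r : ℝ,
        (∀ i, ∀ ξ : Fin n → ℝ, ∀ ω : Fin (k i) → ℝ,
          (∀ l, |ω l| ≤ δ i (fun j => |ξ j|) l) → r < ‖WithLp.toLp 2 ξ‖ →
          ξ ⬝ᵥ (((A i)ᵀ * Pmat V D + Pmat V D * A i) *ᵥ ξ)
            + 2 * (ξ ⬝ᵥ (Pmat V D *ᵥ (H i *ᵥ ω))) < 0) ∧
        (∀ σ w x, IsTrajectory A H δ τ σ w x → ∀ t, 0 ≤ t → r < ‖WithLp.toLp 2 (x t)‖ →
          upperDini (fun s => quadForm (Pmat V D) (x s)) t < 0)) := by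
  have hΛM := isMetzler_Lam A V
  have hunit := isUnit_one_sub_of_specRad_lt_one hR
  have hb := bTilde_nonneg hΛ hΛM hF hR hw
  have hbeq := (add_mulVec_bTilde hΛ.isUnit hunit wbar).le
  obtain ⟨ζ, hζ⟩ := hΛ.exists_isStabilityCertificate hΛM
  obtain ⟨η, hη⟩ := exists_isStabilityCertificate_add hΛ hΛM hF hR
  have hsub : ∀ σ w x, IsTrajectory A H δ τ σ w x → IsDelaySubsolution (Lam A V)
      (fun c => F *ᵥ c + wbar) τ 0 fun t => absMulVec V⁻¹ (x t) :=
    fun σ w x h => (h.isDelaySubsolution hτ hδ_cni hV).mono hτ hψ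
  have hev := fun σ w x h => (hsub σ w x h).eventually_le_add hτ hΛM hb hbeq hη
  refine ⟨⟨hunit, hb⟩, fun σ w x h hstart t ht => ?_,
    fun σ w x h => limsupLe_of_eventually_le_add (hev σ w x h), fun δ' hcont hδ' hle => ?_,
    (hΛM.add fun i j _ => hF i j).exists_isDiagLyap hη, ?_⟩
  · exact (le_total t 0).elim (hstart t ht) ((hsub σ w x h).le_of_le hτ hΛM hb hbeq hη
      fun s hs => hstart s (by simpa using hs.1) hs.2)
  · obtain ⟨b, hlim, hle_b⟩ := (hδ'.tzero (hΛM.neg_inv_nonneg hζ)).exists_tendsto_iterate hb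
      (Tzero_bTilde_le hΛ.isUnit (hΛM.neg_inv_nonneg hζ) hunit (hle _ hb).2)
    refine ⟨b, hlim, hle_b, fun σ w x h => limsupLe_of_eventually_le_add ?_⟩
    have hsub' := (h.isDelaySubsolution hτ hδ_cni hV).mono hτ fun c hc => (hle c hc).1
    exact eventually_le_add_of_tendsto hlim
      (hsub'.eventually_le_iterate_tzero_add hτ hΛM hζ hδ' hcont hb (hev σ w x h))
  · rintro rfl D hD
    exact hD.exists_forall_derivative_neg hδ_cni hV hψ

theorem mainTheorem2 {n N : ℕ} [NeZero N] {k : Fin N → ℕ}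
    (A : Fin N → Matrix (Fin n) (Fin n) ℝ) (H : ∀ i, Matrix (Fin n) (Fin (k i)) ℝ)
    (δ : ∀ i, (Fin n → ℝ) → (Fin (k i) → ℝ))
    (hδ_cont : ∀ i, ContinuousOn (δ i) (Set.Ici 0)) (hδ_cni : ∀ i, IsCNI (δ i))
    (τ : ℝ) (hτ : 0 ≤ τ)
    (V : Matrix (Fin n) (Fin n) ℂ) (hV : IsUnit V)
    (hΛ : IsHurwitz (Lam A V))
    (F : Matrix (Fin n) (Fin n) ℝ) (wbar : Fin n → ℝ)
    (hF : ∀ i j, 0 ≤ F i j) (hw : 0 ≤ wbar)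
    (hψ : ∀ x : Fin n → ℝ, 0 ≤ x → psi H δ V x ≤ F *ᵥ x + wbar)
    (hR : specRad (Rmat (Lam A V) F) < 1) :
    -- the bound is well defined and lies in the nonnegative orthant
    (IsUnit (1 - Rmat (Lam A V) F) ∧ 0 ≤ bTilde (Lam A V) F wbar) ∧
    -- (a) invariance
    (∀ σ w x, IsTrajectory A H δ τ σ w x →
      (∀ t, -τ ≤ t → t ≤ 0 → absMulVec V⁻¹ (x t) ≤ bTilde (Lam A V) F wbar) →
      ∀ t, -τ ≤ t → absMulVec V⁻¹ (x t) ≤ bTilde (Lam A V) F wbar) ∧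
    -- (b) global ultimate bound
    (∀ σ w x, IsTrajectory A H δ τ σ w x →
      LimsupLe (fun t => absMulVec V⁻¹ (x t)) (bTilde (Lam A V) F wbar)) ∧
    -- (c) tighter global ultimate bound
    (∀ δ' : (Fin n → ℝ) → (Fin n → ℝ), ContinuousOn δ' (Set.Ici 0) → IsCNI δ' →
      (∀ x : Fin n → ℝ, 0 ≤ x → psi H δ V x ≤ δ' x ∧ δ' x ≤ F *ᵥ x + wbar) →
      ∃ b : Fin n → ℝ,
        Tendsto (fun m : ℕ => (Tzero (Lam A V) δ')^[m] (bTilde (Lam A V) F wbar)) atTop (𝓝 b) ∧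
        b ≤ bTilde (Lam A V) F wbar ∧
        ∀ σ w x, IsTrajectory A H δ τ σ w x →
          LimsupLe (fun t => absMulVec V⁻¹ (x t)) b) ∧
    -- (d) diagonal Lyapunov matrix
    (∃ D, IsDiagLyap (Lam A V + F) D) ∧
    -- (e) quadratic Lyapunov function in the absence of delay: its derivative is negative outside
    -- a ball, both as the expression `L̇ = x'(A'P + PA)x + 2x'PHw` for every mode, state and
    -- admissible perturbation, and as the upper Dini derivative along every trajectory
    (τ = 0 → ∀ D, IsDiagLyap (Lam A V + F) D →
      ∃ r : ℝ,
        (∀ i, ∀ ξ : Fin n → ℝ, ∀ ω : Fin (k i) → ℝ,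
          (∀ l, |ω l| ≤ δ i (fun j => |ξ j|) l) → r < ‖WithLp.toLp 2 ξ‖ →
          ξ ⬝ᵥ (((A i)ᵀ * Pmat V D + Pmat V D * A i) *ᵥ ξ)
            + 2 * (ξ ⬝ᵥ (Pmat V D *ᵥ (H i *ᵥ ω))) < 0) ∧
        (∀ σ w x, IsTrajectory A H δ τ σ w x → ∀ t, 0 ≤ t → r < ‖WithLp.toLp 2 (x t)‖ →
          upperDini (fun s => quadForm (Pmat V D) (x s)) t < 0)) :=
  mainTheorem2_general A H δ hδ_cni τ hτ V hV hΛ F wbar hF hw hψ hR
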